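/- **Setting.** All logarithms are to base 2; $\log^{(t)}$ is the $t$-fold iterated logarithm and $\log^*x$ is the least $i$ with $\log^{(i)}x<2$. Let $\mathcal X,\mathcal Y,\mathcal Z$ be finite non-empty alphabets, $W_1:\mathcal X\to\mathcal Z$ a discrete memoryless channel from Alice to Bob and $W_2:\mathcal Y\to\mathcal Z$ one from the attacker Oscar to Bob. $\mathrm{Cov}(W)$ is the convex hull of the rows of the stochastic matrix $W$, $\dim W$ its rank, $C$ the Shannon capacity of $W_1$ and $\Delta(P,Q)=\sum_u|P(u)-Q(u)|$. **Protocols.** In an authentication protocol for a finite source space $\mathcal S$, Alice (with a source state $s\in\mathcal S$) and Bob alternately send flows, Alice first and last. Each flow carries a message over a noiseless channel; a flow of Alice may also carry a word, of a length fixed in advance, over $W_1$. Parties are randomized and may reject (then the execution stops and Bob outputs $\perp$); at the end Bob outputs an element of $\mathcal S\cup\{\perp\}$. The round complexity is the number of flows. The protocol is *$\delta$-secure* if, for all $s\in\mathcal S$, (correctness) for every fixed choice of Alice's randomness, if there is no attack then Bob outputs $s$ except with probability at most $\delta$; (type I) for every randomized, computationally unbounded Oscar, who sees all messages and the inputs and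 outputs of $W_1$ and may replace every noiseless message in transit, Bob outputs an element of $\mathcal S\setminus\{s\}$ with probability at most $\delta$; (type II) for every such Oscar who plays the part of Alice towards Bob, with $W_2$ in place of $W_1$, Bob outputs an element of $\mathcal S$ with probability at most $\delta$. **The protocol SetAuth\*.** A $(v,b,r,\lambda)$-set system is a family of $b$ subsets (blocks) of a $v$-element set such that each point lies in at least $r$ blocks and any two distinct points lie together in at most $\lambda$ blocks. Let $a\in\mathcal X$ with $W_1(\cdot|a)\notin\mathrm{Cov}(W_2)$ and $\gamma=\min_{Q\in \mathrm{Cov}(W_2)}\Delta(W_1(\cdot|a),Q)$. Let $0<R<C$, $\beta_1\in(0,R/4)$, $\beta_2\in(0,R-4\beta_1)$, and for each $n'$ let a code of length $n'$ with $\lfloor 2^{n'R}\rfloor$ codewords $C_i$ for $W_1$ be given, such that the maximum error probability tends to $0$ exponentially in $n'$. For a source space $[v_1]$ with $v_1\ge2$ put $k=\lfloor\sqrt{n'}\rfloor$, $\varepsilon=2^{-\beta_1n'}$, let $\phi$ be the least positive even $t$ with $\log^{(t)}v_1\le\beta_2n'+\sqrt{n'}$, let $v_{j+1}=\big\lfloor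 2^{\phi-j+8}\varepsilon^{-4}\log v_j\big\rfloor$, and for $1\le j<\phi$ take a $(v_j,\,v_{j+1},\,2^{-(\phi-j)/4-2}\varepsilon v_{j+1},\,2^{-(\phi-j)/2-2}\varepsilon^2v_{j+1})$-set system on $[v_j]$ with blocks $\mathcal B_{j,1},\dots,\mathcal B_{j,v_{j+1}}$. To authenticate $s$, put $s_1=s$. For $\ell=1,\dots,\phi$, the party $\mathcal P_\ell$ (Alice for odd $\ell$, Bob for even $\ell$) sends $s_\ell$ noiselessly, and $\mathcal P_{\ell+1}$ receives some $s'_\ell$; $\mathcal P_{\ell+1}$ rejects unless $s_\ell'\in[v_\ell]$ and (if $\ell\geq 2$) $s_{\ell-1}\in\mathcal B_{\ell-1,s'_\ell}$; if $\ell<\phi$, $\mathcal P_{\ell+1}$ takes $s_{\ell+1}$ uniformly at random from $\{i: s'_\ell\in\mathcal B_{\ell,i}\}$. Finally Alice sends $a^k$ followed by the codeword $C_{s'_\phi}$ over $W_1$, and Bob accepts, with output $s_1'$, if and only if for every $u\in\mathcal Z$ the fraction of $u$ among the first $k$ received symbols differs from $W_1(u|a)$ by at most $\gamma/(2|\mathcal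 Z|)$ and the remaining $n'$ symbols are decoded to $s_\phi$. **Theorem.** Assume $\mathrm{Cov}(W_1)\not\subseteq\mathrm{Cov}(W_2)$ and $\dim W_1>1$. Then an input $a$ as above exists, $C>0$, and for every $R\in(0,C)$ codes as above exist. Moreover there is a constant $\xi>0$, depending only on $W_1$ and $W_2$, such that for all $a,R,\beta_1,\beta_2$ and codes as above there is an $N$ such that for all $n'\ge N$ and all $v_1\ge2$ (so $N$ does not depend on $v_1$), with $n=n'+\lfloor\sqrt{n'}\rfloor$: set systems as above exist, and for every choice of them 1. SetAuth\* is a $2^{-\xi\sqrt n}$-secure authentication protocol for $[v_1]$; 2. it uses $W_1$ exactly $n$ times, a number independent of $v_1$; 3. if $v_1>\beta_2n'+\sqrt{n'}$, its round complexity is at most $\log^*v_1-\log^*n+4$; if $v_1\le\beta_2n'+\sqrt{n'}$, it has 3 rounds. -/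

import Mathlib

/-! ## Probabilities, discrete memoryless channels -/

/-- The probability of the event `A` under `p`, as a real number. -/
noncomputable def PMF.prob {α : Type*} (p : PMF α) (A : Set α) : ℝ :=
  (p.toOuterMeasure A).toReal

/-- A discrete channel with input alphabet `X` and output alphabet `Z`: `W x z` is `W(z|x)`. -/
abbrev Channel (X Z : Type*) := X → PMF Z

namespace Channel

variable {X Y Z : Type*}

/-- The stochastic matrix of the channel. -/
noncomputable def toMatrix (W : Channel X Z) : Matrix X Z ℝ :=
  Matrix.of fun x z => (W x z).toReal

/-- `Cov(W)`: the convex hull of the set of rows of the channel matrix. -/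
noncomputable def hull (W : Channel X Z) : Set (Z → ℝ) :=
  convexHull ℝ (Set.range fun x => W.toMatrix x)

/-- Memoryless use of the channel on a word:
`P(z₁ … zₙ | x₁ … xₙ) = ∏ᵢ W(zᵢ | xᵢ)`. -/
noncomputable def transmit [Fintype Z] (W : Channel X Z) {n : ℕ} (x : Fin n → X) :
    PMF (Fin n → Z) :=
  PMF.ofFintype (fun z => ∏ i, W (x i) (z i)) (by
    classical
    have h := Finset.prod_univ_sum (fun _ : Fin n => (Finset.univ : Finset Z))
      (fun i z => W (x i) z)
    rw [Fintype.piFinset_univ] at h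
    rw [← h]
    refine Finset.prod_eq_one fun i _ => ?_
    rw [← tsum_fintype (L := .unconditional _)]
    exact (W (x i)).tsum_coe)

/-- Mutual information, in bits, between the input (with distribution `P`) and the output. -/
noncomputable def mutualInfo [Fintype X] [Fintype Z] (W : Channel X Z) (P : X → ℝ) : ℝ :=
  ∑ x, ∑ z, P x * W.toMatrix x z *
    Real.logb 2 (W.toMatrix x z / ∑ x', P x' * W.toMatrix x' z)

/-- Shannon capacity, in bits per channel use. -/
noncomputable def capacity [Fintype X] [Fintype Z] (W : Channel X Z) : ℝ :=
  sSup (W.mutualInfo '' stdSimplex ℝ X)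

end Channel

/-- Statistical distance `∑ |P z - Q z|` (without the factor `1/2`). -/
noncomputable def statDist {Z : Type*} [Fintype Z] (P Q : Z → ℝ) : ℝ := ∑ z, |P z - Q z|

/-- Statistical distance from `P` to the set `S`. -/
noncomputable def statDistTo {Z : Type*} [Fintype Z] (P : Z → ℝ) (S : Set (Z → ℝ)) : ℝ :=
  sInf (statDist P '' S)

/-- The type of a word: `empirical z u` is the fraction of positions of `z` that hold `u`. -/
noncomputable def empirical {Z : Type*} [DecidableEq Z] {k : ℕ} (z : Fin k → Z) (u : Z) : ℝ :=
  ((Finset.univ.filter fun j => z j = u).card : ℝ) / k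

/-- `log* x`: the least `i` such that the `i`-fold iterate of `log₂` at `x` is less than `2`. -/
noncomputable def logStar (x : ℝ) : ℕ := sInf {i : ℕ | (Real.logb 2)^[i] x < 2}

/-! ## Channel codes -/

/-- A code of length `n` with `M` messages; the decoder may report an error (`none`). -/
structure BlockCode (X Z : Type*) (n M : ℕ) where
  enc : Fin M → Fin n → X
  dec : (Fin n → Z) → Option (Fin M)

/-- Probability that message `i`, sent over `W`, is not decoded to `i`. -/
noncomputable def BlockCode.errorProb {X Z : Type*} [Fintype Z] {n M : ℕ}
    (c : BlockCode X Z n M) (W : Channel X Z) (i : Fin M) : ℝ :=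
  (W.transmit (c.enc i)).prob {z | c.dec z ≠ some i}

/-- A family of codes of rate `R`: for each length `n`, a code with `⌊2 ^ (n R)⌋` codewords. -/
abbrev CodeFamily (X Z : Type*) (R : ℝ) := (n : ℕ) → BlockCode X Z n ⌊(2 : ℝ) ^ ((n : ℝ) * R)⌋₊

/-- The maximum error probability tends to `0` exponentially in the length. -/
def CodeFamily.ExpReliable {X Z : Type*} [Fintype Z] {R : ℝ} (c : CodeFamily X Z R)
    (W : Channel X Z) : Prop :=
  ∃ α : ℝ, 0 < α ∧ ∀ᶠ n : ℕ in Filter.atTop, ∀ i, (c n).errorProb W i ≤ (2 : ℝ) ^ (-(α * n))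

/-! ## Keyless authentication protocols -/

/-- An authentication protocol for the source `𝒮`. Alice sends `turns` flows and Bob answers
each of them except the last with a flow, after which Bob takes his decision; flows
alternate. The flows of Alice are counted from `0`: the `i`-th consists of a word of
`uses i` symbols for the noisy channel and a noiseless message; the flows of Bob are noiseless
messages. Noiseless messages are coded as natural numbers.

Parties are probabilistic: the next action is drawn from a distribution determined by the basic
input and by the local history, i.e. all that the party has sent and received so far. The
action `none` is rejection. The local history of Alice lists, for each earlier turn, her channel
word, her noiseless message, and the answer that reached her; that of Bob lists the
channel output and the noiseless message that reached him, and his answer. -/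
structure AuthProtocol (𝒮 X Z : Type*) where
  turns : ℕ
  uses : ℕ → ℕ
  alice : 𝒮 → (i : ℕ) → List (List X × ℕ × ℕ) → PMF (Option ((Fin (uses i) → X) × ℕ))
  bob : (i : ℕ) → List (List Z × ℕ × ℕ) → (Fin (uses i) → Z) → ℕ → PMF (Option ℕ)
  decide : (i : ℕ) → List (List Z × ℕ × ℕ) → (Fin (uses i) → Z) → ℕ → PMF (Option 𝒮)

/-- One exchange as seen by the attacker between Alice and Bob: channel input `x` and output `z`,
Alice's noiseless message `u` delivered as `u'`, Bob's answer `v` delivered as `v'`. -/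
structure Exchange (X Z : Type*) where
  x : List X
  z : List Z
  u : ℕ
  u' : ℕ
  v : ℕ
  v' : ℕ

/-- A type I attacker: (randomized, computationally unbounded) choice of what is delivered to Bob
and to Alice on the noiseless channel. He sees both ends of the noisy channel, all
noiseless messages and all past deliveries, but he cannot change the noisy transmission. -/
structure TypeIAttacker (X Z : Type*) where
  toBob : List (Exchange X Z) → List X → List Z → ℕ → PMF ℕ
  toAlice : List (Exchange X Z) → List X → List Z → ℕ → ℕ → ℕ → PMF ℕ

/-- The attacker who delivers everything unchanged. -/
noncomputable def TypeIAttacker.passive (X Z : Type*) : TypeIAttacker X Z where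
  toBob := fun _ _ _ u => PMF.pure u
  toAlice := fun _ _ _ _ _ v => PMF.pure v

/-- A type II attacker: he plays the part of Alice, choosing in each turn a word for his own noisy
channel and a noiseless message, from the list of earlier turns (channel word, channel output,
noiseless message, Bob's answer). -/
abbrev TypeIIAttacker (uses : ℕ → ℕ) (Y Z : Type*) :=
  (i : ℕ) → List (List Y × List Z × ℕ × ℕ) → PMF ((Fin (uses i) → Y) × ℕ)

namespace AuthProtocol

variable {𝒮 X Y Z : Type*}

/-- Round complexity: the total number of flows. -/
def rounds (π : AuthProtocol 𝒮 X Z) : ℕ := 2 * π.turns - 1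

/-- Total number of uses of Alice's noisy channel. -/
def channelUses (π : AuthProtocol 𝒮 X Z) : ℕ := ∑ i ∈ Finset.range π.turns, π.uses i

/-- Run the protocol when `k` turns are left, against the type I attacker `O`; Alice's
next actions are drawn from `A`. The result is Bob's output. If a party rejects, the execution
stops and Bob outputs `none`. -/
noncomputable def runI [Fintype Z] (π : AuthProtocol 𝒮 X Z) (W₁ : Channel X Z)
    (A : (i : ℕ) → List (List X × ℕ × ℕ) → PMF (Option ((Fin (π.uses i) → X) × ℕ)))
    (O : TypeIAttacker X Z) : ℕ → List (Exchange X Z) → PMF (Option 𝒮)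
  | 0, _ => PMF.pure none
  | k + 1, H =>
    (A H.length (H.map fun e => (e.x, e.u, e.v'))).bind fun
      | none => PMF.pure none
      | some (x, u) =>
        (W₁.transmit x).bind fun z =>
        (O.toBob H (List.ofFn x) (List.ofFn z) u).bind fun u' =>
        if k = 0 then π.decide H.length (H.map fun e => (e.z, e.u', e.v)) z u'
        else
          (π.bob H.length (H.map fun e => (e.z, e.u', e.v)) z u').bind fun
            | none => PMF.pure none
            | some v =>
              (O.toAlice H (List.ofFn x) (List.ofFn z) u u' v).bind fun v' =>
              runI π W₁ A O k (H ++ [⟨List.ofFn x, List.ofFn z, u, u', v, v'⟩])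

/-- Run the protocol when `k` turns are left, against the type II attacker `O`, who
uses the noisy channel `W₂`. -/
noncomputable def runII [Fintype Z] (π : AuthProtocol 𝒮 X Z) (W₂ : Channel Y Z)
    (O : TypeIIAttacker π.uses Y Z) : ℕ → List (List Y × List Z × ℕ × ℕ) → PMF (Option 𝒮)
  | 0, _ => PMF.pure none
  | k + 1, H =>
    (O H.length H).bind fun a =>
    (W₂.transmit a.1).bind fun z =>
    if k = 0 then π.decide H.length (H.map fun e => e.2) z a.2
    else
      (π.bob H.length (H.map fun e => e.2) z a.2).bind fun
        | none => PMF.pure none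
        | some v => runII π W₂ O k (H ++ [(List.ofFn a.1, List.ofFn z, a.2, v)])

/-- An admissible Alice with source state `s`: her random choices are fixed in an arbitrary way
that the protocol allows (she runs the protocol with some fixed random input). -/
def IsAdmissible (π : AuthProtocol 𝒮 X Z) (s : 𝒮)
    (d : (i : ℕ) → List (List X × ℕ × ℕ) → Option ((Fin (π.uses i) → X) × ℕ)) : Prop :=
  ∀ i T, d i T ∈ (π.alice s i T).support

/-- `δ`-security: correctness and authentication, both up to probability `δ`. -/
structure IsSecure [Fintype Z] (π : AuthProtocol 𝒮 X Z) (W₁ : Channel X Z) (W₂ : Channel Y Z)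
    (δ : ℝ) : Prop where
  /-- Without attack, and for every admissible Alice, Bob recovers the source state. -/
  correct : ∀ s d, π.IsAdmissible s d →
    (π.runI W₁ (fun i T => PMF.pure (d i T)) (TypeIAttacker.passive X Z) π.turns []).prob
      {o | o ≠ some s} ≤ δ
  /-- A type I attacker succeeds if Bob accepts a source state other than Alice's. -/
  typeI : ∀ (s : 𝒮) (O : TypeIAttacker X Z),
    (π.runI W₁ (π.alice s) O π.turns []).prob {o | o ≠ none ∧ o ≠ some s} ≤ δ
  /-- A type II attacker succeeds if Bob accepts any source state. -/
  typeII : ∀ O : TypeIIAttacker π.uses Y Z,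
    (π.runII W₂ O π.turns []).prob {o | o ≠ none} ≤ δ

end AuthProtocol

/-! ## Set systems and the iterated set-system protocol -/

/-- `(|V|, b, r, l)`-set system on `V` with blocks `B 0, …, B (b - 1)`. -/
structure IsSetSystem (V : Finset ℕ) (b : ℕ) (r l : ℝ) (B : ℕ → Finset ℕ) : Prop where
  subset : ∀ i < b, B i ⊆ V
  le_card : ∀ x ∈ V, r ≤ ((Finset.range b).filter fun i => x ∈ B i).card
  card_le : ∀ x ∈ V, ∀ y ∈ V, x ≠ y →
    (((Finset.range b).filter fun i => x ∈ B i ∧ y ∈ B i).card : ℝ) ≤ l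

namespace SetAuth

/-- `ε = 2 ^ (- β₁ n')`. -/
noncomputable def eps (β₁ : ℝ) (n' : ℕ) : ℝ := (2 : ℝ) ^ (-(β₁ * n'))

/-- The threshold `β₂ n' + √n'`. -/
noncomputable def threshold (β₂ : ℝ) (n' : ℕ) : ℝ := β₂ * n' + √(n' : ℝ)

/-- `φ`: the least positive even `t` such that the `t`-fold iterated `log₂` of `v₁` is at most
`β₂ n' + √n'`. -/
noncomputable def phi (β₂ : ℝ) (n' v₁ : ℕ) : ℕ :=
  sInf {t : ℕ | 0 < t ∧ Even t ∧ (Real.logb 2)^[t] (v₁ : ℝ) ≤ threshold β₂ n'}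

/-- The sizes `v 1 = v₁` and `v (j + 1) = ⌊2 ^ (φ - j + 8) / ε ^ 4 * log₂ (v j)⌋` for `j ≥ 1`
(the value at `0` is not used). -/
noncomputable def size (φ : ℕ) (ε : ℝ) (v₁ : ℕ) : ℕ → ℕ
  | 0 => v₁
  | 1 => v₁
  | j + 2 => ⌊(2 : ℝ) ^ ((φ : ℝ) - (j + 1 : ℕ) + 8) / ε ^ 4 *
      Real.logb 2 (size φ ε v₁ (j + 1))⌋₊

/-- `B j` is, for `1 ≤ j < φ`, a set system on `{0, …, v j - 1}` with `v (j + 1)` blocks and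
parameters `r = 2 ^ (- 0.25 (φ - j) - 2) ε v (j + 1)`, `l = 2 ^ (- 0.5 (φ - j) - 2) ε² v (j + 1)`. -/
def AreSetSystems (φ : ℕ) (ε : ℝ) (v : ℕ → ℕ) (B : ℕ → ℕ → Finset ℕ) : Prop :=
  ∀ j, 1 ≤ j → j < φ → IsSetSystem (Finset.range (v j)) (v (j + 1))
    ((2 : ℝ) ^ (-(1 / 4) * ((φ : ℝ) - j) - 2) * ε * v (j + 1))
    ((2 : ℝ) ^ (-(1 / 2) * ((φ : ℝ) - j) - 2) * ε ^ 2 * v (j + 1)) (B j)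

/-- The set systems from which the protocol may be built. -/
def Admits (β₁ β₂ : ℝ) (n' v₁ : ℕ) (B : ℕ → ℕ → Finset ℕ) : Prop :=
  AreSetSystems (phi β₂ n' v₁) (eps β₁ n') (size (phi β₂ n' v₁) (eps β₁ n') v₁) B

/-- The check made on receiving `s'` as the `ℓ`-th message: it is in the right range and, unless
`ℓ = 1`, the receiver's own last message `prev` lies in the block `B (ℓ - 1) s'`. -/
def Check (v : ℕ → ℕ) (B : ℕ → ℕ → Finset ℕ) (ℓ prev s' : ℕ) : Prop :=
  s' < v ℓ ∧ (ℓ = 1 ∨ prev ∈ B (ℓ - 1) s')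

/-- A uniformly random index of a block of the `ℓ`-th system that contains `s'` (rejection if
there is none). -/
noncomputable def pick (v : ℕ → ℕ) (B : ℕ → ℕ → Finset ℕ) (ℓ s' : ℕ) : PMF (Option ℕ) :=
  if h : ((Finset.range (v (ℓ + 1))).filter fun i => s' ∈ B ℓ i).Nonempty then
    (PMF.uniformOfFinset _ h).map some
  else PMF.pure none

/-- The noisy channel is used in the last flow only, for `k + m` symbols. -/
def uses (φ k m : ℕ) (i : ℕ) : ℕ := if 2 * i = φ then k + m else 0

theorem uses_eq {φ k m i : ℕ} (h : 2 * i = φ) : uses φ k m i = k + m := if_pos h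

open Classical in
/-- The iterated set-system protocol. The messages of flows `1, …, φ` are noiseless; flow `ℓ` is
sent by Alice for odd `ℓ`, by Bob for even `ℓ`. In flow `φ + 1` Alice sends `a ^ k` followed by the
codeword of the message `s'` that she received in flow `φ` over the noisy channel (and a dummy
noiseless message `0`). Bob accepts the source state that he received in flow `1` if the type of the
first `k` output symbols is within `γ / (2 |Z|)` of the row of `a` and the rest is decoded to
the message that he sent in flow `φ`. -/
noncomputable def protocol {X Z : Type*} [Fintype Z] (W₁ : Channel X Z) (a : X) (γ : ℝ)
    (k m : ℕ) {M : ℕ} (c : BlockCode X Z m M) (φ : ℕ) (v : ℕ → ℕ) (B : ℕ → ℕ → Finset ℕ) :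
    AuthProtocol (Fin (v 1)) X Z where
  turns := φ / 2 + 1
  uses := uses φ k m
  alice := fun s i T =>
    match T.getLast? with
    | none => PMF.pure (some (fun _ => a, s))
    | some (_, prev, s') =>
      if Check v B (2 * i) prev s' then
        if h : 2 * i = φ then
          if hs : s' < M then
            PMF.pure (some (fun j =>
              Fin.append (fun _ : Fin k => a) (c.enc ⟨s', hs⟩) (Fin.cast (uses_eq h) j), 0))
          else PMF.pure none
        else (pick v B (2 * i) s').map (Option.map fun t => (fun _ => a, t))
      else PMF.pure none
  bob := fun i T _ s' =>
    if Check v B (2 * i + 1) ((T.getLast?.map fun e => e.2.2).getD 0) s' then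
      pick v B (2 * i + 1) s'
    else PMF.pure none
  decide := fun i T z _ =>
    match T.head?, T.getLast? with
    | some (_, s₁', _), some (_, _, sφ) =>
      if h : s₁' < v 1 ∧ 2 * i = φ then
        let z' : Fin (k + m) → Z := fun j => z (Fin.cast (uses_eq h.2).symm j)
        if (∀ u, |empirical (fun j : Fin k => z' (Fin.castAdd m j)) u - W₁.toMatrix a u| ≤
              γ / (2 * Fintype.card Z)) ∧
            (c.dec fun j => z' (Fin.natAdd k j)).map Fin.val = some sφ then
          PMF.pure (some ⟨s₁', h.1⟩)
        else PMF.pure none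
      else PMF.pure none
    | _, _ => PMF.pure none

end SetAuth

/-- The iterated set-system protocol `SetAuth*` for the source `{0, …, v₁ - 1}`, with its
parameters: `k = ⌊√n'⌋`, `γ` the statistical distance of the row of `a` from `Cov(W₂)`, a code `c` of
length `n'` for `W₁`, and set systems `B`. -/
noncomputable def setAuth {X Y Z : Type*} [Fintype Z] (W₁ : Channel X Z) (W₂ : Channel Y Z)
    (a : X) (β₁ β₂ : ℝ) (n' : ℕ) {M : ℕ} (c : BlockCode X Z n' M) (v₁ : ℕ)
    (B : ℕ → ℕ → Finset ℕ) : AuthProtocol (Fin v₁) X Z :=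
  SetAuth.protocol W₁ a (statDistTo (W₁.toMatrix a) W₂.hull) (Nat.sqrt n') n' c
    (SetAuth.phi β₂ n' v₁) (SetAuth.size (SetAuth.phi β₂ n' v₁) (SetAuth.eps β₁ n') v₁) B

/-!
The proof is elementary throughout: all concentration bounds are Chernoff bounds for products of
finite distributions.

*Codes.* That codes of every rate below the capacity exist, with exponentially small maximum
error, is Feinstein's lemma (`exists_codewords_of_sets`) applied to the sets of outputs whose
information density exceeds `n θ`, for `R < θ < I(P, W₁)`; the probability of a smaller density is
at most the `n`-th power of a tilted sum that is less than `1`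
(`Channel.exists_tilted_sum_lt_one`). The capacity is positive because `W₁`, having rank greater
than `1`, has two different rows.

*Set systems.* A family of independent random subsets works: degrees and pair degrees concentrate,
and `ε⁻⁴ log v` blocks suffice for a union bound over the pairs of points (`exists_isSetSystem`).

*Message sizes.* Writing `L j` for the `j`-fold iterated logarithm of `v₁`, the logarithm of the
`j`-th size is at most `L j + O(φ - j + n')`, uniformly in `v₁` (`SetAuth.logb_size_le`). As `L φ`
is at most `β₂ n' + √n'`, the last message is one of about `2 ^ ((4 β₁ + β₂) n' + √n')`, which is
fewer than the code has codewords. The bound on the number of flows compares `φ` with the number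
of logarithms that bring `v₁` below `2`.

*Security.* In an honest run every check passes, and only the noisy flow can fail. In a type I
attack with a substituted source state, let `ρ j = 2 ^ (-(φ - j) / 4) ε`, the ratio of the pair
degree bound to the degree bound: if sender and receiver of flow `j` hold different values, then
the next block picked by the receiver contains the value of the sender with probability at most
`ρ j`, and otherwise the attacker has to change the next message too, or the check fails. The
`ρ j` sum to `O(ε)`, and if the views still differ in flow `φ`, Bob accepts only after a decoding error
(`SetAuth.prob_typeI_le`). In a type II attack the mean output law of the first `k` symbols lies
in `Cov(W₂)`, hence is at distance at least `γ` from the row of `a`, and the type of the output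
concentrates at that mean (`SetAuth.prob_passesTest_le`). The latter error, exponential in
`k = ⌊√n'⌋`, dominates; its rate depends on the two channels only, which is why `ξ` can be chosen
before the remaining parameters.
-/

/-! ### Probabilities of events and sequential composition -/

namespace PMF

variable {α β : Type*}

theorem toOuterMeasure_le_one (p : PMF α) (A : Set α) : p.toOuterMeasure A ≤ 1 := by
  calc p.toOuterMeasure A ≤ p.toOuterMeasure Set.univ :=
        MeasureTheory.measure_mono (Set.subset_univ _)
    _ = 1 := (p.toOuterMeasure_apply_eq_one_iff _).2 (Set.subset_univ _)

theorem toOuterMeasure_ne_top (p : PMF α) (A : Set α) : p.toOuterMeasure A ≠ ⊤ :=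
  ne_top_of_le_ne_top ENNReal.one_ne_top (p.toOuterMeasure_le_one A)

theorem prob_le_iff (p : PMF α) (A : Set α) {δ : ℝ} (hδ : 0 ≤ δ) :
    p.prob A ≤ δ ↔ p.toOuterMeasure A ≤ ENNReal.ofReal δ :=
  (ENNReal.le_ofReal_iff_toReal_le (p.toOuterMeasure_ne_top A) hδ).symm

theorem prob_nonneg (p : PMF α) (A : Set α) : 0 ≤ p.prob A := ENNReal.toReal_nonneg

theorem prob_mono (p : PMF α) {A B : Set α} (h : A ⊆ B) : p.prob A ≤ p.prob B :=
  ENNReal.toReal_mono (p.toOuterMeasure_ne_top B) (MeasureTheory.measure_mono h)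

theorem prob_union_le (p : PMF α) (A B : Set α) : p.prob (A ∪ B) ≤ p.prob A + p.prob B := by
  unfold prob
  rw [← ENNReal.toReal_add (p.toOuterMeasure_ne_top A) (p.toOuterMeasure_ne_top B)]
  exact ENNReal.toReal_mono
    (ENNReal.add_ne_top.2 ⟨p.toOuterMeasure_ne_top A, p.toOuterMeasure_ne_top B⟩)
    (MeasureTheory.measure_union_le A B)

theorem prob_iUnion_le {ι : Type*} [Fintype ι] (p : PMF α) (A : ι → Set α) :
    p.prob (⋃ i, A i) ≤ ∑ i, p.prob (A i) := by
  unfold prob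
  rw [← ENNReal.toReal_sum fun i _ => p.toOuterMeasure_ne_top (A i)]
  exact ENNReal.toReal_mono (ENNReal.sum_ne_top.2 fun i _ => p.toOuterMeasure_ne_top (A i))
    (MeasureTheory.measure_iUnion_fintype_le _ A)

theorem prob_eq_sum [Fintype α] (p : PMF α) (A : Set α) :
    p.prob A = ∑ x, A.indicator (fun x => (p x).toReal) x := by
  classical
  unfold prob
  rw [toOuterMeasure_apply_fintype, ENNReal.toReal_sum]
  · refine Finset.sum_congr rfl fun x _ => ?_
    by_cases h : x ∈ A <;> simp [h]
  · intro x _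
    by_cases h : x ∈ A <;> simp [h, p.apply_ne_top]

theorem sum_toReal_eq_one [Fintype α] (p : PMF α) : ∑ x, (p x).toReal = 1 := by
  rw [← ENNReal.toReal_sum fun x _ => p.apply_ne_top x, ← tsum_fintype (L := .unconditional _),
    p.tsum_coe, ENNReal.toReal_one]

theorem prob_eq_zero (p : PMF α) {A : Set α} (h : ∀ x ∈ p.support, x ∉ A) : p.prob A = 0 := by
  unfold prob
  rw [(p.toOuterMeasure_apply_eq_zero_iff A).2 (Set.disjoint_left.2 h), ENNReal.toReal_zero]

theorem prob_pure_of_notMem {a : α} {A : Set α} (h : a ∉ A) : (pure a).prob A = 0 :=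
  prob_eq_zero _ (by simpa using h)

/-- If the first stage lies in `bad` with probability at most `η`, and from every other outcome the
second stage lies in `A` with probability at most `δ`, then the composite lies in `A` with
probability at most `η + δ`. -/
theorem prob_bind_le_add (p : PMF α) (f : α → PMF β) (A : Set β) (bad : Set α) {η δ : ℝ}
    (hδ : 0 ≤ δ) (hbad : p.prob bad ≤ η)
    (h : ∀ x ∈ p.support, x ∉ bad → (f x).prob A ≤ δ) : (p.bind f).prob A ≤ η + δ := by
  have hη : 0 ≤ η := (p.prob_nonneg bad).trans hbad
  rw [prob_le_iff _ _ hη] at hbad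
  rw [prob_le_iff _ _ (add_nonneg hη hδ), toOuterMeasure_bind_apply, ENNReal.ofReal_add hη hδ]
  calc ∑' a, p a * (f a).toOuterMeasure A
      ≤ ∑' a, (bad.indicator p a + p a * ENNReal.ofReal δ) := by
        refine ENNReal.tsum_le_tsum fun a => ?_
        by_cases ha : a ∈ bad
        · rw [Set.indicator_of_mem ha]
          exact (mul_le_of_le_one_right' ((f a).toOuterMeasure_le_one A)).trans le_self_add
        · rw [Set.indicator_of_notMem ha, zero_add]
          by_cases hs : a ∈ p.support
          · exact mul_le_mul_right ((prob_le_iff _ _ hδ).1 (h a hs ha)) _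
          · rw [(p.apply_eq_zero_iff a).2 hs, zero_mul, zero_mul]
    _ = p.toOuterMeasure bad + ENNReal.ofReal δ := by
        rw [ENNReal.tsum_add, ENNReal.tsum_mul_right, p.tsum_coe, one_mul, toOuterMeasure_apply]
    _ ≤ _ := add_le_add_left hbad _

theorem prob_bind_le (p : PMF α) (f : α → PMF β) (A : Set β) {δ : ℝ} (hδ : 0 ≤ δ)
    (h : ∀ x ∈ p.support, (f x).prob A ≤ δ) : (p.bind f).prob A ≤ δ := by
  have := prob_bind_le_add p f A ∅ (η := 0) hδ (prob_eq_zero p fun _ _ => id).le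
    fun x hx _ => h x hx
  rwa [zero_add] at this

theorem prob_uniformOfFinset_le (s : Finset α) (hs : s.Nonempty) (A : Set α) (t : Finset α)
    (hA : ∀ x ∈ s, x ∈ A → x ∈ t) {ρ : ℝ} (h : (t.card : ℝ) ≤ ρ * s.card) :
    (uniformOfFinset s hs).prob A ≤ ρ := by
  classical
  unfold prob
  have hc : (0 : ℝ) < s.card := by exact_mod_cast hs.card_pos
  rw [toOuterMeasure_uniformOfFinset_apply, ENNReal.toReal_div, ENNReal.toReal_natCast,
    ENNReal.toReal_natCast, div_le_iff₀ hc]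
  refine le_trans ?_ h
  exact_mod_cast Finset.card_le_card fun x hx => by
    rw [Finset.mem_filter] at hx
    exact hA x hx.1 hx.2

end PMF

/-! ### Product distributions and an exponential tail bound -/

section Chernoff

variable {ι Z : Type*} [Fintype ι] [Fintype Z]

/-- Chernoff bound for the number of hits `z j ∈ E j` of independent `z j` with laws `w j`. Both
signs of `s` are allowed, so that it covers the upper and the lower tail. -/
theorem sum_indicator_count_le [DecidableEq ι] (w : ι → Z → ℝ) (hw : ∀ j z, 0 ≤ w j z)
    (hw1 : ∀ j, ∑ z, w j z = 1) (E : ι → Set Z)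
    [∀ j, DecidablePred (· ∈ E j)] (p : ι → ℝ)
    (hp : ∀ j, p j = ∑ z, (E j).indicator (w j) z) {s : ℝ} (hs : |s| ≤ 1) (τ : ℝ)
    (A : Set (ι → Z))
    (hA : ∀ z ∈ A, τ ≤ s * (((Finset.univ.filter fun j => z j ∈ E j).card : ℝ) - ∑ j, p j)) :
    ∑ z, A.indicator (fun z => ∏ j, w j (z j)) z ≤ Real.exp (s ^ 2 * ∑ j, p j - τ) := by
  have hp0 : ∀ j, 0 ≤ p j := fun j => by
    rw [hp]; exact Finset.sum_nonneg fun z _ => Set.indicator_nonneg (fun z _ => hw j z) z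
  have hcount : ∀ z : ι → Z, ∑ j, (E j).indicator (fun _ => (1 : ℝ)) (z j) =
      ((Finset.univ.filter fun j => z j ∈ E j).card : ℝ) := fun z => by
    simp [Set.indicator_apply]
  have hstep : ∀ j, ∑ z, w j z * Real.exp (s * ((E j).indicator (fun _ => (1 : ℝ)) z - p j)) ≤
      Real.exp (s ^ 2 * p j) := fun j => by
    have h1 : ∑ z, w j z * Real.exp (s * ((E j).indicator (fun _ => (1 : ℝ)) z - p j)) =
        Real.exp (-(s * p j)) * (1 + p j * (Real.exp s - 1)) := by
      have : ∀ z, w j z * Real.exp (s * ((E j).indicator (fun _ => (1 : ℝ)) z - p j)) =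
          Real.exp (-(s * p j)) * (w j z + (E j).indicator (w j) z * (Real.exp s - 1)) :=
        fun z => by
        by_cases hz : z ∈ E j
        · rw [Set.indicator_of_mem hz, Set.indicator_of_mem hz,
            show s * (1 - p j) = -(s * p j) + s by ring, Real.exp_add]
          ring
        · rw [Set.indicator_of_notMem hz, Set.indicator_of_notMem hz,
            show s * (0 - p j) = -(s * p j) by ring]
          ring
      rw [Finset.sum_congr rfl fun z _ => this z, ← Finset.mul_sum, Finset.sum_add_distrib, hw1,
        ← Finset.sum_mul, ← hp]
    rw [h1]
    have h2 : 1 + p j * (Real.exp s - 1) ≤ Real.exp (p j * (s + s ^ 2)) := by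
      have h3 : Real.exp s - 1 ≤ s + s ^ 2 := by
        have := (abs_le.1 (Real.abs_exp_sub_one_sub_id_le hs)).2
        linarith
      have h4 := mul_le_mul_of_nonneg_left h3 (hp0 j)
      have h5 := Real.add_one_le_exp (p j * (s + s ^ 2))
      linarith
    calc _ ≤ Real.exp (-(s * p j)) * Real.exp (p j * (s + s ^ 2)) :=
          mul_le_mul_of_nonneg_left h2 (Real.exp_pos _).le
      _ = _ := by rw [← Real.exp_add]; ring_nf
  have hpoint : ∀ z, A.indicator (fun z => ∏ j, w j (z j)) z ≤
      Real.exp (-τ) * ((∏ j, w j (z j)) *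
        ∏ j, Real.exp (s * ((E j).indicator (fun _ => (1 : ℝ)) (z j) - p j))) := fun z => by
    have h0 : 0 ≤ ∏ j, w j (z j) := Finset.prod_nonneg fun j _ => hw j _
    rw [← Real.exp_sum, ← Finset.mul_sum, Finset.sum_sub_distrib, hcount]
    by_cases hz : z ∈ A
    · rw [Set.indicator_of_mem hz, mul_left_comm, ← Real.exp_add]
      refine le_mul_of_one_le_right h0 (Real.one_le_exp ?_)
      linarith [hA z hz]
    · rw [Set.indicator_of_notMem hz]
      positivity
  calc _ ≤ ∑ z : ι → Z, Real.exp (-τ) * ((∏ j, w j (z j)) *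
        ∏ j, Real.exp (s * ((E j).indicator (fun _ => (1 : ℝ)) (z j) - p j))) :=
        Finset.sum_le_sum fun z _ => hpoint z
    _ = Real.exp (-τ) * ∏ j, ∑ z, w j z *
          Real.exp (s * ((E j).indicator (fun _ => (1 : ℝ)) z - p j)) := by
        rw [← Finset.mul_sum, Finset.prod_univ_sum, Fintype.piFinset_univ]
        simp only [Finset.prod_mul_distrib]
    _ ≤ Real.exp (-τ) * ∏ j, Real.exp (s ^ 2 * p j) := by
        refine mul_le_mul_of_nonneg_left (Finset.prod_le_prod (fun j _ => ?_) fun j _ => hstep j)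
          (Real.exp_pos _).le
        exact Finset.sum_nonneg fun z _ => mul_nonneg (hw j z) (Real.exp_pos _).le
    _ = _ := by rw [← Real.exp_sum, ← Real.exp_add, ← Finset.mul_sum]; ring_nf

end Chernoff

/-! ### Transmission of words -/

namespace Channel

variable {X Y Z : Type*}

theorem toMatrix_nonneg (W : Channel X Z) (x : X) (z : Z) : 0 ≤ W.toMatrix x z :=
  ENNReal.toReal_nonneg

variable [Fintype Z]

theorem sum_toMatrix (W : Channel X Z) (x : X) : ∑ z, W.toMatrix x z = 1 :=
  (W x).sum_toReal_eq_one

theorem toReal_transmit (W : Channel X Z) {n : ℕ} (x : Fin n → X) (z : Fin n → Z) :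
    (W.transmit x z).toReal = ∏ i, W.toMatrix (x i) (z i) := by
  simp only [transmit, PMF.ofFintype_apply, ENNReal.toReal_prod, toMatrix, Matrix.of_apply]

theorem prob_transmit (W : Channel X Z) {n : ℕ} (x : Fin n → X) (A : Set (Fin n → Z)) :
    (W.transmit x).prob A = ∑ z, A.indicator (fun z => ∏ i, W.toMatrix (x i) (z i)) z := by
  rw [PMF.prob_eq_sum]
  simp only [toReal_transmit]

theorem sum_prod_toMatrix (W : Channel X Z) {n : ℕ} (x : Fin n → X) :
    ∑ z : Fin n → Z, ∏ i, W.toMatrix (x i) (z i) = 1 := by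
  have := (W.transmit x).sum_toReal_eq_one
  simpa only [toReal_transmit] using this

theorem sum_fin_add (k m : ℕ) (f : (Fin (k + m) → Z) → ℝ) :
    ∑ z, f z = ∑ z₁ : Fin k → Z, ∑ z₂ : Fin m → Z, f (Fin.append z₁ z₂) := by
  rw [← Fintype.sum_prod_type' (f := fun z₁ z₂ => f (Fin.append z₁ z₂))]
  exact (Fintype.sum_equiv (Fin.appendEquiv k m) _ _ fun _ => rfl).symm

theorem prob_transmit_castAdd (W : Channel X Z) {k m : ℕ} (x : Fin (k + m) → X)
    (A : Set (Fin k → Z)) :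
    (W.transmit x).prob {z | (fun j => z (Fin.castAdd m j)) ∈ A} =
      (W.transmit fun j => x (Fin.castAdd m j)).prob A := by
  classical
  rw [prob_transmit, prob_transmit, sum_fin_add]
  refine Finset.sum_congr rfl fun z₁ _ => ?_
  simp only [Set.indicator_apply, Set.mem_ofPred_eq, Fin.append_left, Fin.prod_univ_add,
    Fin.append_right]
  split_ifs
  · rw [← Finset.mul_sum, sum_prod_toMatrix W fun j => x (Fin.natAdd k j), mul_one]
  · exact Finset.sum_const_zero

theorem prob_transmit_natAdd (W : Channel X Z) {k m : ℕ} (x : Fin (k + m) → X)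
    (A : Set (Fin m → Z)) :
    (W.transmit x).prob {z | (fun j => z (Fin.natAdd k j)) ∈ A} =
      (W.transmit fun j => x (Fin.natAdd k j)).prob A := by
  classical
  rw [prob_transmit, prob_transmit, sum_fin_add, Finset.sum_comm]
  refine Finset.sum_congr rfl fun z₂ _ => ?_
  simp only [Set.indicator_apply, Set.mem_ofPred_eq, Fin.append_left, Fin.prod_univ_add,
    Fin.append_right]
  split_ifs
  · rw [← Finset.sum_mul, sum_prod_toMatrix W fun j => x (Fin.castAdd m j), one_mul]
  · exact Finset.sum_const_zero

end Channel

/-! ### The channel coding theorem with exponentially small maximum error -/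

/-- Feinstein's greedy construction, for one use of a channel `W` with input law `P` and output law
`q`. Codewords are added one at a time; the decoding set of a new codeword `x` is the part of `G x`
not yet taken. While no further codeword has error at most `lam`, averaging over `P` shows that the
sets taken so far have `q`-measure at least `lam` minus the average of `W (G x)ᶜ`, whereas each of
them has `q`-measure at most `κ`. -/
theorem exists_codewords_of_sets {𝒳 𝒵 : Type*} [Fintype 𝒳] [Fintype 𝒵] (P : 𝒳 → ℝ)
    (W : 𝒳 → 𝒵 → ℝ) (q : 𝒵 → ℝ) (hP : ∀ x, 0 ≤ P x) (hP1 : ∑ x, P x = 1)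
    (hW : ∀ x z, 0 ≤ W x z) (hq : ∀ z, q z = ∑ x, P x * W x z)
    (G : 𝒳 → Set 𝒵) {κ lam : ℝ} (hκ : 0 < κ) (hG : ∀ x, ∑ z, (G x).indicator q z ≤ κ) (M : ℕ)
    (hlam : ∑ x, P x * ∑ z, (G x)ᶜ.indicator (W x) z + M * κ ≤ lam) :
    ∃ (enc : Fin M → 𝒳) (D : Fin M → Set 𝒵),
      (∀ i j z, z ∈ D i → z ∈ D j → i = j) ∧
      ∀ i, ∑ z, (D i)ᶜ.indicator (W (enc i)) z ≤ lam := by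
  classical
  have hq0 : ∀ z, 0 ≤ q z := fun z => by
    rw [hq]; exact Finset.sum_nonneg fun x _ => mul_nonneg (hP x) (hW x z)
  suffices h : ∀ N ≤ M, ∃ (enc : Fin N → 𝒳) (D : Fin N → Set 𝒵),
      (∀ i j z, z ∈ D i → z ∈ D j → i = j) ∧ (∀ i, D i ⊆ G (enc i)) ∧
      ∀ i, ∑ z, (D i)ᶜ.indicator (W (enc i)) z ≤ lam by
    obtain ⟨enc, D, h1, -, h2⟩ := h M le_rfl
    exact ⟨enc, D, h1, h2⟩
  intro N
  induction N with
  | zero => exact fun _ => ⟨fun i => i.elim0, fun i => i.elim0, fun i => i.elim0,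
      fun i => i.elim0, fun i => i.elim0⟩
  | succ N ih =>
    intro hN
    obtain ⟨enc, D, h1, h2, h3⟩ := ih (by omega)
    set U : Set 𝒵 := ⋃ i, D i with hU
    obtain ⟨x, hx⟩ : ∃ x, ∑ z, (G x \ U)ᶜ.indicator (W x) z ≤ lam := by
      by_contra! hcon
      have hqU : ∑ z, U.indicator q z ≤ N * κ := by
        calc ∑ z, U.indicator q z ≤ ∑ z, ∑ i, (D i).indicator q z := by
              refine Finset.sum_le_sum fun z _ => ?_
              have hnn : ∀ i ∈ Finset.univ, 0 ≤ (D i).indicator q z :=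
                fun i _ => Set.indicator_nonneg (fun z _ => hq0 z) z
              by_cases hz : z ∈ U
              · obtain ⟨i, hi⟩ := Set.mem_iUnion.1 hz
                rw [Set.indicator_of_mem hz]
                calc q z = (D i).indicator q z := (Set.indicator_of_mem hi q).symm
                  _ ≤ _ := Finset.single_le_sum hnn (Finset.mem_univ i)
              · rw [Set.indicator_of_notMem hz]
                exact Finset.sum_nonneg hnn
          _ = ∑ i, ∑ z, (D i).indicator q z := Finset.sum_comm
          _ ≤ ∑ i : Fin N, κ := Finset.sum_le_sum fun i _ =>
              (Finset.sum_le_sum fun z _ => Set.indicator_le_indicator_of_subset (h2 i) hq0 z).trans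
                (hG (enc i))
          _ = N * κ := by simp
      have hav : lam ≤ ∑ x, P x * (∑ z, (G x)ᶜ.indicator (W x) z + ∑ z, U.indicator (W x) z) := by
        calc lam = ∑ x, P x * lam := by rw [← Finset.sum_mul, hP1, one_mul]
          _ ≤ _ := Finset.sum_le_sum fun x _ => mul_le_mul_of_nonneg_left
            ((hcon x).le.trans ?_) (hP x)
        rw [← Finset.sum_add_distrib]
        refine Finset.sum_le_sum fun z _ => ?_
        have := hW x z
        by_cases ha : z ∈ G x <;> by_cases hb : z ∈ U <;> simp [ha, hb, this]
      have hqs : ∑ x, P x * ∑ z, U.indicator (W x) z = ∑ z, U.indicator q z := by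
        simp only [Finset.mul_sum]
        rw [Finset.sum_comm]
        refine Finset.sum_congr rfl fun z _ => ?_
        by_cases hb : z ∈ U <;> simp [hb, hq]
      simp only [mul_add, Finset.sum_add_distrib] at hav
      rw [hqs] at hav
      have hNM : ((N : ℝ) + 1) ≤ M := by exact_mod_cast hN
      have := mul_le_mul_of_nonneg_right hNM hκ.le
      linarith
    refine ⟨Fin.cons x enc, Fin.cons (G x \ U) D, ?_, ?_, ?_⟩
    · intro i j z hi hj
      induction i using Fin.cases with
      | zero =>
        induction j using Fin.cases with
        | zero => rfl
        | succ j => exact absurd (Set.mem_iUnion.2 ⟨j, hj⟩) hi.2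
      | succ i =>
        induction j using Fin.cases with
        | zero => exact absurd (Set.mem_iUnion.2 ⟨i, hi⟩) hj.2
        | succ j => rw [h1 i j z hi hj]
    · intro i
      induction i using Fin.cases with
      | zero => exact Set.sdiff_subset
      | succ i => exact h2 i
    · intro i
      induction i using Fin.cases with
      | zero => exact hx
      | succ i => exact h3 i

namespace Channel

variable {X Y Z : Type*} [Fintype X] [Fintype Z]

open Classical in
/-- The tilted sum `∑ P W (2 ^ θ q / W) ^ s` (over `P W ≠ 0`), with `q` the output law, is
less than `1` for some `s > 0`: its derivative at `0` is a positive multiple of `θ - I(P, W)`. -/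
theorem exists_tilted_sum_lt_one (W : Channel X Z) {P : X → ℝ} (hP : P ∈ stdSimplex ℝ X) {θ : ℝ}
    (hθ : θ < W.mutualInfo P) :
    ∃ s : ℝ, 0 < s ∧ ∑ x, ∑ z, P x * W.toMatrix x z *
      ((2 : ℝ) ^ θ * (∑ x', P x' * W.toMatrix x' z) / W.toMatrix x z) ^ s < 1 := by
  set q : Z → ℝ := fun z => ∑ x', P x' * W.toMatrix x' z with hq
  set f : ℝ → ℝ := fun s => ∑ x, ∑ z, P x * W.toMatrix x z *
      ((2 : ℝ) ^ θ * q z / W.toMatrix x z) ^ s with hf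
  have hf0 : f 0 = 1 := by
    simp only [hf, Real.rpow_zero, mul_one, ← Finset.mul_sum, W.sum_toMatrix, hP.2]
  have hd : HasDerivAt f (∑ x, ∑ z, P x * W.toMatrix x z *
      (Real.log 2 * (θ - Real.logb 2 (W.toMatrix x z / q z)))) 0 := by
    refine HasDerivAt.fun_sum fun x _ => HasDerivAt.fun_sum fun z _ => ?_
    rcases (mul_nonneg (hP.1 x) (W.toMatrix_nonneg x z)).eq_or_lt with h0 | h0
    · simp only [← h0, zero_mul]
      exact hasDerivAt_const _ _
    · have hW : 0 < W.toMatrix x z := by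
        refine (W.toMatrix_nonneg x z).lt_of_ne fun h => ?_
        rw [← h, mul_zero] at h0
        exact h0.false
      have hqz : 0 < q z := h0.trans_le
        (Finset.single_le_sum (f := fun x' => P x' * W.toMatrix x' z)
          (fun x' _ => mul_nonneg (hP.1 x') (W.toMatrix_nonneg x' z)) (Finset.mem_univ x))
      have h2 : (0 : ℝ) < 2 ^ θ := by positivity
      have hc : 0 < (2 : ℝ) ^ θ * q z / W.toMatrix x z := by positivity
      have hlog : Real.log ((2 : ℝ) ^ θ * q z / W.toMatrix x z) =
          Real.log 2 * (θ - Real.logb 2 (W.toMatrix x z / q z)) := by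
        have : Real.log 2 ≠ 0 := (Real.log_pos one_lt_two).ne'
        rw [Real.log_div (by positivity) hW.ne', Real.log_mul h2.ne' hqz.ne',
          Real.log_rpow two_pos, Real.logb, Real.log_div hW.ne' hqz.ne']
        field_simp
        ring
      have := (Real.hasStrictDerivAt_const_rpow hc 0).hasDerivAt.const_mul
        (P x * W.toMatrix x z)
      rwa [Real.rpow_zero, one_mul, hlog] at this
  have hneg : ∑ x, ∑ z, P x * W.toMatrix x z *
      (Real.log 2 * (θ - Real.logb 2 (W.toMatrix x z / q z))) < 0 := by
    have : ∑ x, ∑ z, P x * W.toMatrix x z *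
        (Real.log 2 * (θ - Real.logb 2 (W.toMatrix x z / q z))) =
        Real.log 2 * (θ - W.mutualInfo P) := by
      have h1 : θ = ∑ x, ∑ z, P x * W.toMatrix x z * θ := by
        simp only [← Finset.sum_mul, ← Finset.mul_sum, W.sum_toMatrix, mul_one, hP.2, one_mul]
      conv_rhs => rw [h1, mutualInfo, ← Finset.sum_sub_distrib, Finset.mul_sum]
      refine Finset.sum_congr rfl fun x _ => ?_
      rw [← Finset.sum_sub_distrib, Finset.mul_sum]
      refine Finset.sum_congr rfl fun z _ => ?_
      ring
    rw [this]
    exact mul_neg_of_pos_of_neg (Real.log_pos one_lt_two) (sub_neg.2 hθ)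
  have hslope := (hasDerivAt_iff_tendsto_slope.1 hd).eventually (gt_mem_nhds hneg)
  have hright := hslope.filter_mono (nhdsWithin_mono 0 fun s (hs : s ∈ Set.Ioi (0 : ℝ)) => hs.ne')
  obtain ⟨s, hs, hs0⟩ := (hright.and self_mem_nhdsWithin).exists
  refine ⟨s, hs0, ?_⟩
  have hs0 : 0 < s := hs0
  rw [slope_def_field, sub_zero, div_neg_iff] at hs
  rcases hs with ⟨_, h⟩ | ⟨h, _⟩
  · exact absurd h hs0.not_gt
  · rw [hf0] at h
    exact sub_neg.1 h

/-- Feinstein's bound for block length `n`: `θ` is the threshold of the information density per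
symbol, and the sum to the power `n` is the Chernoff bound for the probability that the density is
below the threshold. -/
theorem exists_blockCode (W : Channel X Z) {P : X → ℝ} (hP : P ∈ stdSimplex ℝ X) (θ : ℝ) {s : ℝ}
    (hs : 0 < s) (n M : ℕ) :
    ∃ c : BlockCode X Z n M, ∀ i, c.errorProb W i ≤ (∑ x, ∑ z, P x * W.toMatrix x z *
      ((2 : ℝ) ^ θ * (∑ x', P x' * W.toMatrix x' z) / W.toMatrix x z) ^ s) ^ n +
        M * ((2 : ℝ) ^ (-θ)) ^ n := by
  classical
  set q : Z → ℝ := fun z => ∑ x', P x' * W.toMatrix x' z with hq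
  have hq0 : ∀ z, 0 ≤ q z := fun z =>
    Finset.sum_nonneg fun x _ => mul_nonneg (hP.1 x) (W.toMatrix_nonneg x z)
  have hWn : ∀ (x : Fin n → X) (z : Fin n → Z), 0 ≤ ∏ j, W.toMatrix (x j) (z j) :=
    fun x z => Finset.prod_nonneg fun j _ => W.toMatrix_nonneg _ _
  have h2 : (0 : ℝ) < 2 ^ θ := by positivity
  set G : (Fin n → X) → Set (Fin n → Z) := fun x =>
    {z | ((2 : ℝ) ^ θ) ^ n * ∏ j, q (z j) < ∏ j, W.toMatrix (x j) (z j)} with hGdef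
  have hG : ∀ x, ∑ z, (G x).indicator (fun z : Fin n → Z => ∏ j, q (z j)) z ≤
      ((2 : ℝ) ^ (-θ)) ^ n := fun x => by
    have : ((2 : ℝ) ^ (-θ)) ^ n = ∑ z : Fin n → Z, ((2 : ℝ) ^ (-θ)) ^ n *
        ∏ j, W.toMatrix (x j) (z j) := by
      rw [← Finset.mul_sum, W.sum_prod_toMatrix, mul_one]
    rw [this]
    refine Finset.sum_le_sum fun z _ => ?_
    by_cases hz : z ∈ G x
    · rw [Set.indicator_of_mem hz, Real.rpow_neg two_pos.le, inv_pow, ← div_eq_inv_mul,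
        le_div_iff₀ (by positivity), mul_comm]
      exact le_of_lt hz
    · rw [Set.indicator_of_notMem hz]
      exact mul_nonneg (by positivity) (hWn x z)
  have hbad : ∑ x : Fin n → X, (∏ j, P (x j)) *
      ∑ z, (G x)ᶜ.indicator (fun z => ∏ j, W.toMatrix (x j) (z j)) z ≤
      (∑ x, ∑ z, P x * W.toMatrix x z * ((2 : ℝ) ^ θ * q z / W.toMatrix x z) ^ s) ^ n := by
    rw [Fintype.sum_pow]
    refine Finset.sum_le_sum fun x _ => ?_
    rw [Finset.prod_univ_sum, Fintype.piFinset_univ, Finset.mul_sum]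
    refine Finset.sum_le_sum fun z _ => ?_
    have hPn : 0 ≤ ∏ j, P (x j) := Finset.prod_nonneg fun j _ => hP.1 _
    rw [Finset.prod_mul_distrib, Finset.prod_mul_distrib]
    have hr : 0 ≤ ∏ j, ((2 : ℝ) ^ θ * q (z j) / W.toMatrix (x j) (z j)) ^ s :=
      Finset.prod_nonneg fun j _ => Real.rpow_nonneg
        (div_nonneg (mul_nonneg h2.le (hq0 _)) (W.toMatrix_nonneg _ _)) _
    by_cases hz : z ∈ G x
    · rw [Set.indicator_of_notMem (by simpa using hz), mul_zero]
      exact mul_nonneg (mul_nonneg hPn (hWn x z)) hr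
    · rw [Set.indicator_of_mem (by simpa using hz)]
      rcases (hWn x z).eq_or_lt with h0 | h0
      · rw [← h0]; simp
      · refine le_mul_of_one_le_right (mul_nonneg hPn (hWn x z)) ?_
        rw [Real.finsetProd_rpow _ _ fun j _ =>
          div_nonneg (mul_nonneg h2.le (hq0 _)) (W.toMatrix_nonneg _ _)]
        refine Real.one_le_rpow ?_ hs.le
        rw [Finset.prod_div_distrib, Finset.prod_mul_distrib, Finset.prod_const,
          Finset.card_univ, Fintype.card_fin, one_le_div h0]
        exact not_lt.1 hz
  obtain ⟨enc, D, hD, herr⟩ := exists_codewords_of_sets (fun x : Fin n → X => ∏ j, P (x j))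
    (fun x (z : Fin n → Z) => ∏ j, W.toMatrix (x j) (z j)) (fun z => ∏ j, q (z j))
    (fun x => Finset.prod_nonneg fun j _ => hP.1 _)
    (by rw [← Fintype.sum_pow, hP.2, one_pow]) hWn
    (fun z => by
      simp only [hq, ← Finset.prod_mul_distrib]
      rw [Finset.prod_univ_sum, Fintype.piFinset_univ])
    G (κ := ((2 : ℝ) ^ (-θ)) ^ n) (by positivity) hG M
    (add_le_add_left hbad _)
  refine ⟨⟨enc, fun z => if h : ∃ i, z ∈ D i then some h.choose else none⟩, fun i => ?_⟩
  refine le_trans ?_ (herr i)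
  rw [← W.prob_transmit]
  refine PMF.prob_mono _ fun z hz hzi => hz ?_
  have hex : ∃ i, z ∈ D i := ⟨i, hzi⟩
  simp only [dif_pos hex]
  rw [hD _ _ z hex.choose_spec hzi]

/-- Achievability half of Shannon's channel coding theorem. -/
theorem exists_expReliable [Nonempty X] (W : Channel X Z) {R : ℝ} (hR : R < W.capacity) :
    ∃ c : CodeFamily X Z R, c.ExpReliable W := by
  classical
  have hne : (W.mutualInfo '' stdSimplex ℝ X).Nonempty :=
    ⟨_, _, single_mem_stdSimplex ℝ (Classical.arbitrary X), rfl⟩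
  obtain ⟨_, ⟨P, hP, rfl⟩, hPR⟩ := exists_lt_of_lt_csSup hne hR
  obtain ⟨θ, hθR, hθ⟩ := exists_between hPR
  obtain ⟨s, hs, hf⟩ := W.exists_tilted_sum_lt_one hP hθ
  choose c hc using fun n : ℕ => W.exists_blockCode hP θ hs n ⌊(2 : ℝ) ^ ((n : ℝ) * R)⌋₊
  refine ⟨c, ?_⟩
  set f := ∑ x, ∑ z, P x * W.toMatrix x z *
      ((2 : ℝ) ^ θ * (∑ x', P x' * W.toMatrix x' z) / W.toMatrix x z) ^ s with hfdef
  have hf0 : 0 ≤ f := Finset.sum_nonneg fun x _ => Finset.sum_nonneg fun z _ =>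
    mul_nonneg (mul_nonneg (hP.1 x) (W.toMatrix_nonneg x z)) <| Real.rpow_nonneg
      (div_nonneg (mul_nonneg (by positivity) <| Finset.sum_nonneg fun x _ =>
        mul_nonneg (hP.1 x) (W.toMatrix_nonneg x z)) (W.toMatrix_nonneg x z)) _
  set A := (2 : ℝ) ^ (R - θ) with hA
  have hA0 : 0 < A := by positivity
  have hA1 : A < 1 := Real.rpow_lt_one_of_one_lt_of_neg one_lt_two (by linarith)
  obtain ⟨C, hmC, hC1⟩ := exists_between (max_lt hf hA1)
  have hC0 : 0 < C := hA0.trans ((le_max_right f A).trans_lt hmC)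
  refine ⟨-Real.logb 2 C, neg_pos.2 (Real.logb_neg one_lt_two hC0 hC1), ?_⟩
  have hlim : Filter.Tendsto (fun n : ℕ => (f / C) ^ n + (A / C) ^ n) Filter.atTop (nhds 0) := by
    have h1 := tendsto_pow_atTop_nhds_zero_of_lt_one (div_nonneg hf0 hC0.le)
      ((div_lt_one hC0).2 ((le_max_left f A).trans_lt hmC))
    have h2 := tendsto_pow_atTop_nhds_zero_of_lt_one (div_nonneg hA0.le hC0.le)
      ((div_lt_one hC0).2 ((le_max_right f A).trans_lt hmC))
    simpa using h1.add h2
  filter_upwards [hlim.eventually (gt_mem_nhds one_pos)] with n hn i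
  have hCn : (2 : ℝ) ^ (-(-Real.logb 2 C * n)) = C ^ n := by
    rw [neg_mul, neg_neg, Real.rpow_mul two_pos.le, Real.rpow_logb two_pos (by norm_num) hC0,
      Real.rpow_natCast]
  rw [hCn]
  have hM : (⌊(2 : ℝ) ^ ((n : ℝ) * R)⌋₊ : ℝ) * ((2 : ℝ) ^ (-θ)) ^ n ≤ A ^ n := by
    refine (mul_le_mul_of_nonneg_right (Nat.floor_le (by positivity)) (by positivity)).trans ?_
    rw [mul_comm (n : ℝ) R, Real.rpow_mul two_pos.le, Real.rpow_natCast, ← mul_pow,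
      ← Real.rpow_add two_pos, hA, sub_eq_add_neg]
  have hpos : 0 < C ^ n := by positivity
  rw [div_pow, div_pow, ← add_div, div_lt_one hpos] at hn
  exact (hc n i).trans ((add_le_add_right hM _).trans hn.le)

/-! ### Positivity of the capacity -/

theorem bddAbove_mutualInfo (W : Channel X Z) :
    BddAbove (W.mutualInfo '' stdSimplex ℝ X) := by
  refine ⟨∑ _x : X, ∑ _z : Z, 1 / Real.log 2, ?_⟩
  rintro _ ⟨P, hP, rfl⟩
  refine Finset.sum_le_sum fun x _ => Finset.sum_le_sum fun z _ => ?_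
  have hl := Real.log_pos one_lt_two
  have hW := W.toMatrix_nonneg x z
  set q := ∑ x', P x' * W.toMatrix x' z with hq
  rcases (mul_nonneg (hP.1 x) hW).eq_or_lt with h0 | h0
  · rw [← h0, zero_mul]; positivity
  · have hle : P x * W.toMatrix x z ≤ q :=
      Finset.single_le_sum (f := fun x' => P x' * W.toMatrix x' z)
        (fun x' _ => mul_nonneg (hP.1 x') (W.toMatrix_nonneg x' z)) (Finset.mem_univ x)
    have hqz : 0 < q := h0.trans_le hle
    have hW0 : 0 < W.toMatrix x z := hW.lt_of_ne fun h => by simp [← h] at h0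
    have hW1 : W.toMatrix x z ≤ 1 := by
      rw [← W.sum_toMatrix x]
      exact Finset.single_le_sum (fun z _ => W.toMatrix_nonneg x z) (Finset.mem_univ z)
    rw [Real.logb, ← mul_div_assoc]
    refine div_le_div_of_nonneg_right ?_ hl.le
    calc P x * W.toMatrix x z * Real.log (W.toMatrix x z / q)
        ≤ P x * W.toMatrix x z * (W.toMatrix x z / q) :=
          mul_le_mul_of_nonneg_left (Real.log_le_self (by positivity)) h0.le
      _ = P x * W.toMatrix x z / q * W.toMatrix x z := by ring
      _ ≤ 1 * 1 := mul_le_mul ((div_le_one hqz).2 hle) hW1 hW0.le zero_le_one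
      _ = 1 := one_mul 1

/-- With the uniform input law, the mutual information of a channel with two different rows is
positive, by the strict form of `log t ≥ 1 - 1 / t`. -/
theorem capacity_pos (W : Channel X Z) (h : 1 < W.toMatrix.rank) : 0 < W.capacity := by
  classical
  have hne : Nonempty X := by
    by_contra hX
    rw [not_nonempty_iff] at hX
    have := W.toMatrix.rank_le_card_height
    rw [Fintype.card_eq_zero] at this
    omega
  set N : ℝ := (Fintype.card X : ℝ) with hN
  have hN0 : 0 < N := by
    rw [hN]; exact_mod_cast Fintype.card_pos
  set P : X → ℝ := fun _ => 1 / N with hPdef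
  have hP : P ∈ stdSimplex ℝ X := ⟨fun _ => by positivity, by simp [hPdef, hN]⟩
  set q : Z → ℝ := fun z => ∑ x', P x' * W.toMatrix x' z with hq
  refine lt_of_lt_of_le ?_ (le_csSup W.bddAbove_mutualInfo ⟨P, hP, rfl⟩)
  have hl := Real.log_pos one_lt_two
  have hq1 : ∑ z, q z = 1 := by
    rw [hq, Finset.sum_comm]
    simp only [← Finset.mul_sum, W.sum_toMatrix, mul_one, hP.2]
  -- some entry lies strictly above the mean of its column
  obtain ⟨x₀, z₀, h₀⟩ : ∃ x z, q z < W.toMatrix x z := by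
    by_contra! hcon
    have hrow : ∀ x z, W.toMatrix x z = q z := fun x z =>
      (Finset.sum_eq_sum_iff_of_le fun z _ => hcon x z).1
        ((W.sum_toMatrix x).trans hq1.symm) z (Finset.mem_univ z)
    have : W.toMatrix = Matrix.vecMulVec (fun _ => 1) q := by
      ext x z; simp [Matrix.vecMulVec_apply, hrow]
    rw [this] at h
    exact absurd (Matrix.rank_vecMulVec_le _ _) (not_le.2 h)
  have hterm : ∀ x z, P x * (W.toMatrix x z - q z) / Real.log 2 ≤
      P x * W.toMatrix x z * Real.logb 2 (W.toMatrix x z / q z) ∧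
      (q z < W.toMatrix x z → P x * (W.toMatrix x z - q z) / Real.log 2 <
      P x * W.toMatrix x z * Real.logb 2 (W.toMatrix x z / q z)) := fun x z => by
    have hPx : 0 < P x := by positivity
    rcases (W.toMatrix_nonneg x z).eq_or_lt with hW | hW
    · have hqz : 0 ≤ q z := Finset.sum_nonneg fun x _ => mul_nonneg (hP.1 x) (W.toMatrix_nonneg x z)
      rw [← hW]
      refine ⟨?_, fun hlt => absurd hlt hqz.not_gt⟩
      rw [mul_zero, zero_mul]
      exact div_nonpos_of_nonpos_of_nonneg
        (mul_nonpos_of_nonneg_of_nonpos hPx.le (by linarith)) hl.le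
    · have hqz : 0 < q z := (mul_pos hPx hW).trans_le
        (Finset.single_le_sum (f := fun x' => P x' * W.toMatrix x' z)
          (fun x' _ => mul_nonneg (hP.1 x') (W.toMatrix_nonneg x' z)) (Finset.mem_univ x))
      have hrw : P x * W.toMatrix x z * Real.logb 2 (W.toMatrix x z / q z) =
          P x * (W.toMatrix x z * -Real.log (q z / W.toMatrix x z)) / Real.log 2 := by
        rw [Real.logb, ← Real.log_inv, inv_div]; ring
      have hrw2 : P x * (W.toMatrix x z - q z) =
          P x * (W.toMatrix x z * -(q z / W.toMatrix x z - 1)) := by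
        field_simp; ring
      rw [hrw, hrw2]
      refine ⟨div_le_div_of_nonneg_right (mul_le_mul_of_nonneg_left (mul_le_mul_of_nonneg_left
        (neg_le_neg (Real.log_le_sub_one_of_pos (by positivity))) hW.le) hPx.le) hl.le,
        fun hlt => ?_⟩
      refine div_lt_div_of_pos_right (mul_lt_mul_of_pos_left (mul_lt_mul_of_pos_left
        (neg_lt_neg (Real.log_lt_sub_one_of_pos (by positivity) ?_)) hW) hPx) hl
      exact ((div_lt_one hW).2 hlt).ne
  have hzero : ∑ x, ∑ z, P x * (W.toMatrix x z - q z) / Real.log 2 = 0 := by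
    simp only [← Finset.sum_div, ← Finset.mul_sum, Finset.sum_sub_distrib, W.sum_toMatrix, hq1,
      sub_self, mul_zero, Finset.sum_const_zero, zero_div]
  rw [← hzero]
  exact Finset.sum_lt_sum (fun x _ => Finset.sum_le_sum fun z _ => (hterm x z).1)
    ⟨x₀, Finset.mem_univ _, Finset.sum_lt_sum (fun z _ => (hterm x₀ z).1)
      ⟨z₀, Finset.mem_univ _, (hterm x₀ z₀).2 h₀⟩⟩

end Channel

/-! ### Random set systems -/

section RandomSubset

variable {V : Type*} [Fintype V]

/-- The law of the random subset of `V` (as an indicator function) that contains every point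
independently with probability `p`. -/
def randomSubset (p : ℝ) (h : V → Bool) : ℝ := ∏ x, if h x then p else 1 - p

theorem randomSubset_nonneg {p : ℝ} (h0 : 0 ≤ p) (h1 : p ≤ 1) (h : V → Bool) :
    0 ≤ randomSubset p h :=
  Finset.prod_nonneg fun x _ => by split_ifs <;> linarith

theorem sum_randomSubset_indicator [DecidableEq V] (p : ℝ) (S : Finset V) :
    ∑ h : V → Bool, {h : V → Bool | ∀ x ∈ S, h x}.indicator (randomSubset p) h = p ^ S.card := by
  classical
  have key : ∀ h : V → Bool, {h : V → Bool | ∀ x ∈ S, h x}.indicator (randomSubset p) h =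
      ∏ x, (fun (x : V) (c : Bool) => (if c then p else 1 - p) *
        if x ∈ S then (if c then (1 : ℝ) else 0) else 1) x (h x) := fun h => by
    simp only [Finset.prod_mul_distrib]
    by_cases hh : ∀ x ∈ S, h x
    · rw [Set.indicator_of_mem (show h ∈ {h : V → Bool | ∀ x ∈ S, h x} from hh),
        Finset.prod_eq_one (s := Finset.univ) (f := fun x =>
          if x ∈ S then (if h x then (1 : ℝ) else 0) else 1), mul_one]
      · rfl
      · intro x _
        by_cases hx : x ∈ S
        · rw [if_pos hx, if_pos (hh x hx)]
        · rw [if_neg hx]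
    · rw [Set.indicator_of_notMem (show h ∉ {h : V → Bool | ∀ x ∈ S, h x} from hh)]
      push Not at hh
      obtain ⟨x, hx, hhx⟩ := hh
      rw [Finset.prod_eq_zero (Finset.mem_univ x) (f := fun x =>
        if x ∈ S then (if h x then (1 : ℝ) else 0) else 1), mul_zero]
      rw [if_pos hx, if_neg hhx]
  rw [Finset.sum_congr rfl fun h _ => key h]
  have := Finset.prod_univ_sum (fun _ : V => (Finset.univ : Finset Bool))
    (fun x c => (if c then p else 1 - p) * if x ∈ S then (if c then (1 : ℝ) else 0) else 1)
  rw [Fintype.piFinset_univ] at this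
  rw [← this, ← Finset.prod_const, ← Finset.prod_subset (Finset.subset_univ S)]
  · exact Finset.prod_congr rfl fun x hx => by simp [hx]
  · intro x _ hx
    simp [hx]

theorem sum_randomSubset [DecidableEq V] (p : ℝ) : ∑ h : V → Bool, randomSubset p h = 1 := by
  simpa using sum_randomSubset_indicator p (∅ : Finset V)

end RandomSubset

/-- A family of `b` independent random blocks, each containing every point with probability `θ /
3`, is a set system with degrees at least `θ b / 4` (three quarters of the mean) and pair degrees
at most `θ² b / 4` (nine quarters of the mean), with positive probability. -/
theorem exists_isSetSystem {v b : ℕ} (hv : 2 ≤ v) {θ : ℝ} (hθ : 0 < θ) (hθ1 : θ ≤ 1)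
    (hb : 600 * Real.log v ≤ θ ^ 2 * b) :
    ∃ B, IsSetSystem (Finset.range v) b (θ * b / 4) (θ ^ 2 * b / 4) B := by
  classical
  set p : ℝ := θ / 3 with hp
  have hp0 : 0 ≤ p := by positivity
  have hp1 : p ≤ 1 := by linarith
  set μ : (Fin b → Fin v → Bool) → ℝ := fun f => ∏ j, randomSubset p (f j) with hμ
  have hμ0 : ∀ f, 0 ≤ μ f := fun f => Finset.prod_nonneg fun j _ => randomSubset_nonneg hp0 hp1 _
  have hμ1 : ∑ f, μ f = 1 := by
    rw [hμ, ← Fintype.sum_pow, sum_randomSubset, one_pow]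
  have hbnn : (0 : ℝ) ≤ b := Nat.cast_nonneg b
  have hθb : θ ^ 2 * b ≤ θ * b := by
    rw [pow_two, mul_assoc]; exact mul_le_of_le_one_left (by positivity) hθ1
  set count : (Fin b → Fin v → Bool) → Finset (Fin v) → ℝ := fun f S =>
    ((Finset.univ.filter fun j => f j ∈ {h : Fin v → Bool | ∀ x ∈ S, h x}).card : ℝ) with hcount
  -- lower tail for the degrees
  have hdeg : ∀ x : Fin v, ∑ f, {f | count f {x} < θ * b / 4}.indicator μ f ≤
      Real.exp (-(θ ^ 2 * b / 192)) := fun x => by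
    refine (sum_indicator_count_le (fun _ => randomSubset p)
      (fun _ => randomSubset_nonneg hp0 hp1) (fun _ => sum_randomSubset p)
      (fun _ => {h : Fin v → Bool | ∀ y ∈ ({x} : Finset (Fin v)), h y}) (fun _ => p ^ 1)
      (fun _ => ?_) (s := -(1 / 8)) (by rw [abs_neg, abs_of_pos] <;> norm_num)
      (θ * b / 96) {f | count f {x} < θ * b / 4} fun f hf => ?_).trans ?_
    · exact (sum_randomSubset_indicator p {x}).symm
    · have hf' : count f {x} < θ * b / 4 := hf
      simp only [pow_one, Finset.sum_const, Finset.card_univ, Fintype.card_fin, nsmul_eq_mul]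
      change θ * b / 96 ≤ -(1 / 8) * (count f {x} - b * p)
      rw [hp]; linarith
    · simp only [pow_one, Finset.sum_const, Finset.card_univ, Fintype.card_fin, nsmul_eq_mul]
      rw [Real.exp_le_exp, hp]; linarith
  -- upper tail for the pair degrees
  have hpair : ∀ x y : Fin v, x ≠ y → ∑ f, {f | θ ^ 2 * b / 4 < count f {x, y}}.indicator μ f ≤
      Real.exp (-(θ ^ 2 * b / 192)) := fun x y hxy => by
    refine (sum_indicator_count_le (fun _ => randomSubset p)
      (fun _ => randomSubset_nonneg hp0 hp1) (fun _ => sum_randomSubset p)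
      (fun _ => {h : Fin v → Bool | ∀ z ∈ ({x, y} : Finset (Fin v)), h z}) (fun _ => p ^ 2)
      (fun _ => ?_) (s := 1 / 4) (by rw [abs_of_pos] <;> norm_num)
      (5 * (θ ^ 2 * b) / 144) {f | θ ^ 2 * b / 4 < count f {x, y}} fun f hf => ?_).trans ?_
    · rw [sum_randomSubset_indicator p {x, y}, Finset.card_pair hxy]
    · have hf' : θ ^ 2 * b / 4 < count f {x, y} := hf
      simp only [Finset.sum_const, Finset.card_univ, Fintype.card_fin, nsmul_eq_mul]
      change 5 * (θ ^ 2 * b) / 144 ≤ 1 / 4 * (count f {x, y} - b * p ^ 2)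
      rw [hp]; linarith
    · simp only [Finset.sum_const, Finset.card_univ, Fintype.card_fin, nsmul_eq_mul]
      rw [Real.exp_le_exp, hp]
      have : 0 ≤ θ ^ 2 * b := by positivity
      linarith
  obtain ⟨f, hf1, hf2⟩ : ∃ f, (∀ x, θ * b / 4 ≤ count f {x}) ∧
      ∀ x y, x ≠ y → count f {x, y} ≤ θ ^ 2 * b / 4 := by
    by_contra! hcon
    have hle : ∀ f, μ f ≤ ∑ x, {f | count f {x} < θ * b / 4}.indicator μ f +
        ∑ x, ∑ y, if x ≠ y then {f | θ ^ 2 * b / 4 < count f {x, y}}.indicator μ f else 0 :=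
      fun f => by
      have h1 : ∀ x, 0 ≤ {f | count f {x} < θ * b / 4}.indicator μ f :=
        fun x => Set.indicator_nonneg (fun f _ => hμ0 f) f
      have h2 : ∀ x y, 0 ≤ if x ≠ y then
          {f | θ ^ 2 * b / 4 < count f {x, y}}.indicator μ f else 0 := fun x y => by
        split_ifs
        · exact Set.indicator_nonneg (fun f _ => hμ0 f) f
        · exact le_rfl
      have h2' : ∀ x, 0 ≤ ∑ y, if x ≠ y then
          {f | θ ^ 2 * b / 4 < count f {x, y}}.indicator μ f else 0 :=
        fun x => Finset.sum_nonneg fun y _ => h2 x y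
      by_cases hx : ∀ x, θ * b / 4 ≤ count f {x}
      · obtain ⟨x, y, hxy, hlt⟩ := hcon f hx
        refine le_add_of_nonneg_of_le (Finset.sum_nonneg fun x _ => h1 x) ?_
        calc μ f = if x ≠ y then {f | θ ^ 2 * b / 4 < count f {x, y}}.indicator μ f else 0 := by
              rw [if_pos hxy]
              exact (Set.indicator_of_mem
                (show f ∈ {f | θ ^ 2 * b / 4 < count f {x, y}} from hlt) μ).symm
          _ ≤ _ := Finset.single_le_sum (f := fun y => if x ≠ y then
              {f | θ ^ 2 * b / 4 < count f {x, y}}.indicator μ f else 0)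
              (fun y _ => h2 x y) (Finset.mem_univ y)
          _ ≤ _ := Finset.single_le_sum (f := fun x => ∑ y, if x ≠ y then
              {f | θ ^ 2 * b / 4 < count f {x, y}}.indicator μ f else 0)
              (fun x _ => h2' x) (Finset.mem_univ x)
      · push Not at hx
        obtain ⟨x, hlt⟩ := hx
        refine le_add_of_le_of_nonneg ?_ (Finset.sum_nonneg fun x _ => h2' x)
        calc μ f = {f | count f {x} < θ * b / 4}.indicator μ f :=
              (Set.indicator_of_mem (show f ∈ {f | count f {x} < θ * b / 4} from hlt) μ).symm
          _ ≤ _ := Finset.single_le_sum (f := fun x =>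
              {f | count f {x} < θ * b / 4}.indicator μ f) (fun x _ => h1 x) (Finset.mem_univ x)
    have hsum := Finset.sum_le_sum fun f (_ : f ∈ Finset.univ) => hle f
    rw [hμ1, Finset.sum_add_distrib] at hsum
    have hA : ∑ f, ∑ x : Fin v, {f | count f {x} < θ * b / 4}.indicator μ f ≤
        v * Real.exp (-(θ ^ 2 * b / 192)) := by
      rw [Finset.sum_comm]
      calc _ ≤ ∑ _x : Fin v, Real.exp (-(θ ^ 2 * b / 192)) := Finset.sum_le_sum fun x _ => hdeg x
        _ = _ := by simp
    have hB : ∑ f, ∑ x : Fin v, ∑ y : Fin v, (if x ≠ y then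
        {f | θ ^ 2 * b / 4 < count f {x, y}}.indicator μ f else 0) ≤
        v * (v * Real.exp (-(θ ^ 2 * b / 192))) := by
      rw [Finset.sum_comm]
      calc _ = ∑ x : Fin v, ∑ y : Fin v, ∑ f, (if x ≠ y then
            {f | θ ^ 2 * b / 4 < count f {x, y}}.indicator μ f else 0) :=
            Finset.sum_congr rfl fun x _ => Finset.sum_comm
        _ ≤ ∑ _x : Fin v, ∑ _y : Fin v, Real.exp (-(θ ^ 2 * b / 192)) := by
            refine Finset.sum_le_sum fun x _ => Finset.sum_le_sum fun y _ => ?_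
            by_cases hxy : x = y
            · simp [hxy, (Real.exp_pos _).le]
            · simpa [hxy] using hpair x y hxy
        _ = _ := by simp
    have hv' : (2 : ℝ) ≤ v := by exact_mod_cast hv
    have hv0 : (0 : ℝ) < v := by linarith
    have hlog : 0 < Real.log v := Real.log_pos (by linarith)
    have hexp : Real.exp (-(θ ^ 2 * b / 192)) < ((v : ℝ) ^ 3)⁻¹ := by
      rw [← Real.exp_log (show (0 : ℝ) < ((v : ℝ) ^ 3)⁻¹ by positivity), Real.exp_lt_exp,
        Real.log_inv, Real.log_pow]
      push_cast
      linarith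
    have hfin : (v + v * v) * ((v : ℝ) ^ 3)⁻¹ ≤ 1 := by
      rw [← div_eq_mul_inv, div_le_one (by positivity)]
      nlinarith [mul_pos hv0 hv0]
    have hstrict := mul_lt_mul_of_pos_left hexp (show (0 : ℝ) < v + v * v by positivity)
    have hall : (1 : ℝ) ≤ (v + v * v) * Real.exp (-(θ ^ 2 * b / 192)) := by
      linarith
    linarith
  have hcard : ∀ S : Finset (Fin v),
      ((Finset.range b).filter fun i => ∀ x ∈ S, ∃ h : i < b, f ⟨i, h⟩ x).card =
      (Finset.univ.filter fun j => f j ∈ {h : Fin v → Bool | ∀ x ∈ S, h x}).card := fun S => by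
    refine (Finset.card_bij (fun (j : Fin b) _ => (j : ℕ)) ?_ ?_ ?_).symm
    · intro j hj
      rw [Finset.mem_filter] at hj ⊢
      exact ⟨Finset.mem_range.2 j.2, fun x hx => ⟨j.2, hj.2 x hx⟩⟩
    · exact fun i _ j _ h => Fin.ext h
    · intro i hi
      rw [Finset.mem_filter, Finset.mem_range] at hi
      refine ⟨⟨i, hi.1⟩, ?_, rfl⟩
      rw [Finset.mem_filter]
      exact ⟨Finset.mem_univ _, fun x hx => (hi.2 x hx).2⟩
  refine ⟨fun i => (Finset.range v).filter fun x => ∃ (h : i < b) (h' : x < v), f ⟨i, h⟩ ⟨x, h'⟩,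
    fun i _ => Finset.filter_subset _ _, fun x hx => ?_, fun x hx y hy hxy => ?_⟩
  · have hx := Finset.mem_range.1 hx
    refine (hf1 ⟨x, hx⟩).trans (le_of_eq ?_)
    rw [hcount]
    dsimp only
    rw [← hcard, Nat.cast_inj]
    congr 1
    refine Finset.filter_congr fun i _ => ?_
    simp [hx]
  · have hx := Finset.mem_range.1 hx
    have hy := Finset.mem_range.1 hy
    refine (le_of_eq ?_).trans (hf2 ⟨x, hx⟩ ⟨y, hy⟩ fun h => hxy (by simpa using h))
    rw [hcount]
    dsimp only
    rw [← hcard, Nat.cast_inj]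
    congr 1
    refine Finset.filter_congr fun i _ => ?_
    simp [hx, hy]

/-! ### Iterated logarithms -/

theorem logb_two_le_sub_one {x : ℝ} (hx : 2 ≤ x) : Real.logb 2 x ≤ x - 1 := by
  rw [Real.logb_le_iff_le_rpow one_lt_two (by linarith)]
  have := one_add_mul_self_le_rpow_one_add (s := 1) (p := x - 1) (by norm_num) (by linarith)
  norm_num at this
  exact this

theorem one_le_logb_two {x : ℝ} (hx : 2 ≤ x) : 1 ≤ Real.logb 2 x := by
  rw [Real.le_logb_iff_rpow_le one_lt_two (by linarith), Real.rpow_one]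
  exact hx

theorem exists_iterate_logb_lt_two (x : ℝ) : ∃ i, (Real.logb 2)^[i] x < 2 := by
  suffices h : ∀ n : ℕ, ∀ x : ℝ, x < n + 2 → ∃ i, (Real.logb 2)^[i] x < 2 by
    obtain ⟨n, hn⟩ := exists_nat_gt x
    exact h n x (by linarith)
  intro n
  induction n with
  | zero => exact fun x hx => ⟨0, by simpa using hx⟩
  | succ n ih =>
    intro x hx
    push_cast at hx
    by_cases h : x < 2
    · exact ⟨0, h⟩
    · obtain ⟨i, hi⟩ := ih (Real.logb 2 x) (by linarith [logb_two_le_sub_one (not_lt.1 h)])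
      exact ⟨i + 1, hi⟩

theorem logStar_of_lt {x : ℝ} (hx : x < 2) : logStar x = 0 :=
  Nat.le_zero.1 (Nat.sInf_le (show 0 ∈ {i : ℕ | (Real.logb 2)^[i] x < 2} from hx))

theorem iterate_logStar_lt (x : ℝ) : (Real.logb 2)^[logStar x] x < 2 :=
  Nat.sInf_mem (s := {i : ℕ | (Real.logb 2)^[i] x < 2}) (exists_iterate_logb_lt_two x)

theorem two_le_iterate_of_lt_logStar {x : ℝ} {i : ℕ} (hi : i < logStar x) :
    2 ≤ (Real.logb 2)^[i] x :=
  not_lt.1 fun h => Nat.notMem_of_lt_sInf hi h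

theorem logStar_of_two_le {x : ℝ} (hx : 2 ≤ x) : logStar x = logStar (Real.logb 2 x) + 1 := by
  apply le_antisymm
  · exact Nat.sInf_le (show logStar (Real.logb 2 x) + 1 ∈ {i : ℕ | (Real.logb 2)^[i] x < 2} from
      iterate_logStar_lt (Real.logb 2 x))
  · by_contra! h
    have h1 := iterate_logStar_lt x
    rcases hk : logStar x with _ | k
    · rw [hk] at h1
      exact absurd h1 (not_lt.2 hx)
    · rw [hk] at h1 h
      exact absurd h1 (not_lt.2 (two_le_iterate_of_lt_logStar (x := Real.logb 2 x)
        (Nat.lt_of_succ_lt_succ h)))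

theorem logStar_mono {x y : ℝ} (hxy : x ≤ y) : logStar x ≤ logStar y := by
  induction hn : logStar y generalizing x y with
  | zero =>
    have := iterate_logStar_lt y
    rw [hn] at this
    rw [logStar_of_lt (hxy.trans_lt this)]
  | succ n ih =>
    by_cases hx : x < 2
    · rw [logStar_of_lt hx]; exact Nat.zero_le _
    · have hx := not_lt.1 hx
      rw [logStar_of_two_le (hx.trans hxy)] at hn
      rw [logStar_of_two_le hx]
      exact Nat.succ_le_succ (ih (Real.logb_le_logb_of_le one_lt_two (by linarith) hxy)
        (Nat.succ_injective hn))

theorem logStar_two_rpow {x : ℝ} (hx : 1 ≤ x) : logStar ((2 : ℝ) ^ x) = logStar x + 1 := by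
  rw [logStar_of_two_le, Real.logb_rpow two_pos (by norm_num)]
  calc (2 : ℝ) = 2 ^ (1 : ℝ) := (Real.rpow_one 2).symm
    _ ≤ _ := Real.rpow_le_rpow_of_exponent_le one_le_two hx

theorem logStar_eq_add_logStar_iterate {x : ℝ} {t : ℕ} (h : ∀ j < t, 2 ≤ (Real.logb 2)^[j] x) :
    logStar x = t + logStar ((Real.logb 2)^[t] x) := by
  induction t with
  | zero => simp
  | succ t ih =>
    rw [ih fun j hj => h j (hj.trans t.lt_succ_self), logStar_of_two_le (h t t.lt_succ_self),
      Function.iterate_succ_apply']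
    ring

/-! ### The number of flows -/

namespace SetAuth

section Phi

variable {β₂ : ℝ} {n' v₁ : ℕ}

theorem phi_spec (hthr : 2 ≤ threshold β₂ n') (hv : 2 ≤ v₁) :
    0 < phi β₂ n' v₁ ∧ Even (phi β₂ n' v₁) ∧
      (Real.logb 2)^[phi β₂ n' v₁] (v₁ : ℝ) ≤ threshold β₂ n' := by
  refine Nat.sInf_mem (s := {t : ℕ | 0 < t ∧ Even t ∧
    (Real.logb 2)^[t] (v₁ : ℝ) ≤ threshold β₂ n'}) ?_
  have hv' : (2 : ℝ) ≤ v₁ := by exact_mod_cast hv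
  have h0 := iterate_logStar_lt (v₁ : ℝ)
  rcases hi : logStar (v₁ : ℝ) with _ | i
  · rw [hi] at h0
    exact absurd h0 (not_lt.2 hv')
  · have h1 := two_le_iterate_of_lt_logStar (x := (v₁ : ℝ)) (i := i) (by omega)
    rw [hi] at h0
    rcases Nat.even_or_odd (i + 1) with he | ho
    · exact ⟨i + 1, Nat.succ_pos _, he, h0.le.trans hthr⟩
    · refine ⟨i + 2, Nat.succ_pos _, ho.add_one, ?_⟩
      have h2 : 1 ≤ (Real.logb 2)^[i + 1] (v₁ : ℝ) := by
        rw [Function.iterate_succ_apply']; exact one_le_logb_two h1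
      rw [Function.iterate_succ_apply']
      refine le_trans ?_ hthr
      rw [Real.logb_le_iff_le_rpow one_lt_two (by linarith)]
      refine h0.le.trans ?_
      norm_num

theorem threshold_lt_of_lt_phi {t : ℕ} (ht : t < phi β₂ n' v₁) (h0 : 0 < t) (he : Even t) :
    threshold β₂ n' < (Real.logb 2)^[t] (v₁ : ℝ) :=
  not_le.1 fun h => Nat.notMem_of_lt_sInf ht ⟨h0, he, h⟩

theorem one_le_iterate_of_lt_phi (hthr : 2 ≤ threshold β₂ n') (hv : 2 ≤ v₁) {t : ℕ}
    (ht : t < phi β₂ n' v₁) : 1 ≤ (Real.logb 2)^[t] (v₁ : ℝ) := by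
  have hv' : (2 : ℝ) ≤ v₁ := by exact_mod_cast hv
  rcases t with _ | t
  · simp only [Function.iterate_zero, id_eq]; linarith
  rcases Nat.even_or_odd (t + 1) with he | ho
  · linarith [threshold_lt_of_lt_phi ht (Nat.succ_pos _) he]
  · rw [Function.iterate_succ_apply']
    apply one_le_logb_two
    rcases t with _ | t
    · exact hv'
    · have : Even (t + 1) := by
        by_contra h
        exact (Nat.not_even_iff_odd.2 ho) ((Nat.not_even_iff_odd.1 h).add_one)
      linarith [threshold_lt_of_lt_phi (t := t + 1) (Nat.lt_of_succ_lt ht) (Nat.succ_pos _) this]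

theorem two_le_iterate_of_add_two_lt_phi (hthr : 2 ≤ threshold β₂ n') (hv : 2 ≤ v₁) {t : ℕ}
    (ht : t + 2 < phi β₂ n' v₁) : 2 ≤ (Real.logb 2)^[t] (v₁ : ℝ) := by
  have hv' : (2 : ℝ) ≤ v₁ := by exact_mod_cast hv
  rcases Nat.even_or_odd t with he | ho
  · rcases t.eq_zero_or_pos with rfl | h0
    · exact hv'
    · linarith [threshold_lt_of_lt_phi ((Nat.lt_add_of_pos_right two_pos).trans ht) h0 he]
  · have h1 := one_le_iterate_of_lt_phi hthr hv ((Nat.lt_add_of_pos_right two_pos).trans ht)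
    have h2 := threshold_lt_of_lt_phi (Nat.lt_of_succ_lt ht) (Nat.succ_pos _) ho.add_one
    rw [Function.iterate_succ_apply'] at h2
    by_contra! hlt
    have h3 : Real.logb 2 ((Real.logb 2)^[t] (v₁ : ℝ)) ≤ 1 := by
      rw [Real.logb_le_iff_le_rpow one_lt_two (by linarith), Real.rpow_one]
      exact hlt.le
    linarith

theorem phi_eq_two (hthr : 2 ≤ threshold β₂ n') (hv : 2 ≤ v₁)
    (h : (v₁ : ℝ) ≤ threshold β₂ n') : phi β₂ n' v₁ = 2 := by
  obtain ⟨h0, he, -⟩ := phi_spec hthr hv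
  have hle : phi β₂ n' v₁ ≤ 2 := by
    refine Nat.sInf_le ⟨two_pos, even_two, ?_⟩
    have hv' : (2 : ℝ) ≤ v₁ := by exact_mod_cast hv
    have h1 := one_le_logb_two hv'
    have h2 := logb_two_le_sub_one hv'
    change Real.logb 2 (Real.logb 2 v₁) ≤ _
    rw [Real.logb_le_iff_le_rpow one_lt_two (by linarith)]
    have h3 : ((v₁ : ℝ) - 1) + 1 ≤ (2 : ℝ) ^ (threshold β₂ n') := by
      have h4 := one_add_mul_self_le_rpow_one_add (s := 1) (p := threshold β₂ n')
        (by norm_num) (by linarith)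
      norm_num at h4
      linarith
    linarith
  obtain ⟨m, hm⟩ := he
  omega

theorem phi_add_one_le (hthr : 2 ≤ threshold β₂ n') (hv : 2 ≤ v₁) (h : threshold β₂ n' < v₁)
    {n : ℝ} (hn : n ≤ (2 : ℝ) ^ threshold β₂ n') :
    ((phi β₂ n' v₁ + 1 : ℕ) : ℤ) ≤ (logStar v₁ : ℤ) - (logStar n : ℤ) + 4 := by
  obtain ⟨h0, he, -⟩ := phi_spec hthr hv
  have h1 : logStar n ≤ logStar (threshold β₂ n') + 1 := by
    rw [← logStar_two_rpow (by linarith)]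
    exact logStar_mono hn
  have h2 : phi β₂ n' v₁ - 2 + logStar (threshold β₂ n') ≤ logStar (v₁ : ℝ) := by
    rw [logStar_eq_add_logStar_iterate (x := (v₁ : ℝ)) (t := phi β₂ n' v₁ - 2)
      fun j hj => two_le_iterate_of_add_two_lt_phi hthr hv (by omega)]
    refine Nat.add_le_add_left (logStar_mono ?_) _
    rcases (phi β₂ n' v₁ - 2).eq_zero_or_pos with hz | hz
    · rw [hz]; exact h.le
    · refine (threshold_lt_of_lt_phi (by omega) hz ?_).le
      exact (Nat.even_sub (by omega)).2 (by simp [he])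
  obtain ⟨m, hm⟩ := he
  omega

end Phi

/-! ### The sizes of the message spaces -/

section Size

variable {φ : ℕ} {ε c : ℝ} {v₁ : ℕ}

theorem size_succ (φ : ℕ) (ε : ℝ) (v₁ : ℕ) {j : ℕ} (hj : 1 ≤ j) : size φ ε v₁ (j + 1) =
    ⌊(2 : ℝ) ^ ((φ : ℝ) - j + 8) / ε ^ 4 * Real.logb 2 (size φ ε v₁ j)⌋₊ := by
  obtain ⟨i, rfl⟩ := Nat.exists_eq_add_of_le' hj
  rfl

theorem size_factor (φ : ℕ) (hε : ε ^ 4 = (2 : ℝ) ^ (-c)) (j : ℕ) :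
    (2 : ℝ) ^ ((φ : ℝ) - j + 8) / ε ^ 4 = (2 : ℝ) ^ ((φ : ℝ) - j + 8 + c) := by
  rw [hε, ← Real.rpow_sub two_pos, sub_neg_eq_add]

theorem two_le_size (hε : ε ^ 4 = (2 : ℝ) ^ (-c)) (hc : 0 ≤ c) (hv : 2 ≤ v₁) {j : ℕ}
    (hj : 1 ≤ j) (hjφ : j ≤ φ) : 2 ≤ size φ ε v₁ j := by
  induction j, hj using Nat.le_induction with
  | base => exact hv
  | succ j hj ih =>
    have ih := ih (by omega)
    have ih' : (2 : ℝ) ≤ size φ ε v₁ j := by exact_mod_cast ih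
    rw [size_succ φ ε v₁ hj, size_factor φ hε]
    apply Nat.le_floor
    have hφ : (j : ℝ) + 1 ≤ φ := by exact_mod_cast hjφ
    calc ((2 : ℕ) : ℝ) = (2 : ℝ) ^ (1 : ℝ) * 1 := by norm_num
      _ ≤ _ := mul_le_mul (Real.rpow_le_rpow_of_exponent_le one_le_two (by linarith))
          (one_le_logb_two ih') zero_le_one (by positivity)

/-- `2 ^ y ≥ 2 y + 3` in logarithmic form. -/
theorem logb_two_mul_add_three_le {y : ℝ} (hy : 8 ≤ y) : Real.logb 2 (2 * y + 3) ≤ y := by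
  rw [Real.logb_le_iff_le_rpow one_lt_two (by linarith)]
  have h := one_add_mul_self_le_rpow_one_add (s := 1) (p := y - 3) (by norm_num) (by linarith)
  have h2 : (2 : ℝ) ^ y = 8 * 2 ^ (y - 3) := by
    rw [show y = 3 + (y - 3) by ring, Real.rpow_add two_pos, add_sub_cancel]; norm_num
  norm_num at h
  rw [h2]
  linarith

/-- The logarithm of the `j`-th size exceeds the `j`-fold iterated logarithm of `v₁` by a term that
is linear in `φ - j + c` only. -/
theorem logb_size_le (hε : ε ^ 4 = (2 : ℝ) ^ (-c)) (hc : 0 ≤ c) (hv : 2 ≤ v₁)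
    (hL : ∀ t < φ, 1 ≤ (Real.logb 2)^[t] (v₁ : ℝ)) {j : ℕ} (hj : 1 ≤ j) (hjφ : j < φ) :
    Real.logb 2 (size φ ε v₁ j) ≤
      (Real.logb 2)^[j] (v₁ : ℝ) + 2 * ((φ : ℝ) - j + 9 + c) := by
  induction j, hj using Nat.le_induction with
  | base =>
    have hφ : ((1 : ℕ) : ℝ) ≤ φ := by exact_mod_cast hjφ.le
    change Real.logb 2 (v₁ : ℝ) ≤ Real.logb 2 (v₁ : ℝ) + _
    linarith
  | succ j hj ih =>
    have ih := ih (by omega)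
    have hφ : (j : ℝ) + 1 ≤ φ := by exact_mod_cast hjφ.le
    have h2 : (2 : ℝ) ≤ size φ ε v₁ j := by exact_mod_cast two_le_size hε hc hv hj (by omega)
    have h2' : (2 : ℝ) ≤ size φ ε v₁ (j + 1) := by
      exact_mod_cast two_le_size hε hc hv (by omega) hjφ.le
    have ha := one_le_logb_two h2
    have hLj := hL j (by omega)
    set y : ℝ := (φ : ℝ) - j + 8 + c with hy
    set a := Real.logb 2 (size φ ε v₁ j) with hadef
    have h3 : (size φ ε v₁ (j + 1) : ℝ) ≤ 2 ^ y * a := by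
      rw [size_succ φ ε v₁ hj, size_factor φ hε]
      exact Nat.floor_le (by positivity)
    have h4 : a ≤ (Real.logb 2)^[j] (v₁ : ℝ) * (2 * y + 3) := by
      have : 0 ≤ ((Real.logb 2)^[j] (v₁ : ℝ) - 1) * (2 * y + 2) :=
        mul_nonneg (by linarith) (by linarith)
      linarith
    have h5 : Real.logb 2 a ≤ (Real.logb 2)^[j + 1] (v₁ : ℝ) + Real.logb 2 (2 * y + 3) := by
      rw [Function.iterate_succ_apply', ← Real.logb_mul (by linarith) (by linarith)]
      exact Real.logb_le_logb_of_le one_lt_two (by linarith) h4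
    have h6 : Real.logb 2 (size φ ε v₁ (j + 1)) ≤ y + Real.logb 2 a := by
      refine (Real.logb_le_logb_of_le one_lt_two (by linarith) h3).trans (le_of_eq ?_)
      rw [Real.logb_mul (by positivity) (by linarith), Real.logb_rpow two_pos (by norm_num)]
    have h7 := logb_two_mul_add_three_le (y := y) (by linarith)
    push_cast
    linarith

theorem size_phi_le (hε : ε ^ 4 = (2 : ℝ) ^ (-c)) (hc : 0 ≤ c) (hv : 2 ≤ v₁) (hφ2 : 2 ≤ φ)
    (hL : ∀ t < φ, 1 ≤ (Real.logb 2)^[t] (v₁ : ℝ)) {T : ℝ}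
    (hT : (Real.logb 2)^[φ] (v₁ : ℝ) ≤ T) :
    (size φ ε v₁ φ : ℝ) ≤ 2 ^ (9 + c) * (2 ^ T + 2 * (10 + c)) := by
  obtain ⟨j, rfl⟩ : ∃ j, φ = j + 1 := ⟨φ - 1, by omega⟩
  have hj : 1 ≤ j := by omega
  have h1 := logb_size_le hε hc hv hL hj j.lt_succ_self
  have hLj := hL j j.lt_succ_self
  rw [Function.iterate_succ_apply', Real.logb_le_iff_le_rpow one_lt_two (by linarith)] at hT
  have h2 : (2 : ℝ) ≤ size (j + 1) ε v₁ j := by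
    exact_mod_cast two_le_size hε hc hv hj (by omega)
  have ha := one_le_logb_two h2
  push_cast at h1
  rw [size_succ _ ε v₁ hj, size_factor _ hε]
  refine (Nat.floor_le (by positivity)).trans ?_
  push_cast
  rw [show (j : ℝ) + 1 - j + 8 + c = 9 + c by ring]
  refine mul_le_mul_of_nonneg_left ?_ (by positivity)
  linarith

theorem exists_areSetSystems (hε : ε ^ 4 = (2 : ℝ) ^ (-c)) (hc : 0 ≤ c) (hε0 : 0 < ε)
    (hε1 : ε ≤ 1 / 4) (hv : 2 ≤ v₁) : ∃ B, AreSetSystems φ ε (size φ ε v₁) B := by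
  classical
  have key : ∀ j, 1 ≤ j → j < φ → ∃ B : ℕ → Finset ℕ,
      IsSetSystem (Finset.range (size φ ε v₁ j)) (size φ ε v₁ (j + 1))
      ((2 : ℝ) ^ (-(1 / 4) * ((φ : ℝ) - j) - 2) * ε * size φ ε v₁ (j + 1))
      ((2 : ℝ) ^ (-(1 / 2) * ((φ : ℝ) - j) - 2) * ε ^ 2 * size φ ε v₁ (j + 1)) B := by
    intro j hj hjφ
    have hφ : (j : ℝ) + 1 ≤ φ := by exact_mod_cast hjφ
    set d : ℝ := (φ : ℝ) - j with hd
    have hd1 : 1 ≤ d := by linarith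
    set b := size φ ε v₁ (j + 1) with hb
    set θ : ℝ := 2 ^ (-(1 / 4) * d) * ε with hθ
    have hsq : θ ^ 2 = 2 ^ (-(1 / 2) * d) * ε ^ 2 := by
      rw [hθ, mul_pow, ← Real.rpow_natCast, ← Real.rpow_mul two_pos.le]
      congr 2; push_cast; ring
    have e2 : (2 : ℝ) ^ (-2 : ℝ) = 1 / 4 := by
      rw [Real.rpow_neg two_pos.le]; norm_num
    have hr : (2 : ℝ) ^ (-(1 / 4) * d - 2) * ε * b = θ * b / 4 := by
      rw [sub_eq_add_neg, Real.rpow_add two_pos, e2, hθ]; ring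
    have hl : (2 : ℝ) ^ (-(1 / 2) * d - 2) * ε ^ 2 * b = θ ^ 2 * b / 4 := by
      rw [sub_eq_add_neg, Real.rpow_add two_pos, e2, hsq]; ring
    rw [hr, hl]
    have h2 := two_le_size (φ := φ) hε hc hv hj hjφ.le
    have h2' : (2 : ℝ) ≤ size φ ε v₁ j := by exact_mod_cast h2
    refine exists_isSetSystem h2 (by positivity) ?_ ?_
    · calc θ ≤ 1 * 1 := mul_le_mul (Real.rpow_le_one_of_one_le_of_nonpos one_le_two (by linarith))
            (by linarith) hε0.le zero_le_one
        _ = 1 := one_mul 1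
    · set a := Real.logb 2 (size φ ε v₁ j) with ha
      have ha1 : 1 ≤ a := one_le_logb_two h2'
      have hlog : Real.log (size φ ε v₁ j) ≤ a := by
        rw [ha, Real.logb, le_div_iff₀ (Real.log_pos one_lt_two)]
        refine mul_le_of_le_one_right (Real.log_nonneg (by linarith)) ?_
        linarith [Real.log_two_lt_d9]
      -- the floor costs at most a factor of two
      have hbl : (2 : ℝ) ^ (d + 7) / ε ^ 4 * a ≤ b := by
        have h7 : (2 : ℝ) ^ (d + 8) = 2 * 2 ^ (d + 7) := by
          rw [show d + 8 = 1 + (d + 7) by ring, Real.rpow_add two_pos, Real.rpow_one]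
        have hfl : (2 : ℝ) ^ (d + 8) / ε ^ 4 * a < b + 1 := by
          rw [hb, size_succ φ ε v₁ hj]; exact Nat.lt_floor_add_one _
        have h1b : (1 : ℝ) ≤ b := by
          exact_mod_cast one_le_two.trans (two_le_size (φ := φ) hε hc hv (by omega) hjφ)
        rw [h7, mul_div_assoc, mul_assoc] at hfl
        linarith
      have hexp : (2 : ℝ) ^ (-(1 / 2) * d) * 2 ^ (d + 7) ≥ 128 := by
        rw [← Real.rpow_add two_pos]
        calc (128 : ℝ) = 2 ^ (7 : ℝ) := by norm_num
          _ ≤ _ := Real.rpow_le_rpow_of_exponent_le one_le_two (by linarith)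
      have hε2 : 16 ≤ ε ^ 2 / ε ^ 4 := by
        have : ε ^ 2 / ε ^ 4 = 1 / ε ^ 2 := by field_simp
        rw [this, le_div_iff₀ (by positivity)]
        nlinarith
      calc 600 * Real.log (size φ ε v₁ j) ≤ 600 * a := by linarith
        _ ≤ 128 * 16 * a := by linarith
        _ ≤ (2 ^ (-(1 / 2) * d) * 2 ^ (d + 7)) * (ε ^ 2 / ε ^ 4) * a :=
            mul_le_mul_of_nonneg_right (mul_le_mul hexp hε2 (by norm_num) (by positivity))
              (by linarith)
        _ = θ ^ 2 * (2 ^ (d + 7) / ε ^ 4 * a) := by rw [hsq]; ring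
        _ ≤ θ ^ 2 * b := mul_le_mul_of_nonneg_left hbl (by positivity)
  choose B hB using key
  exact ⟨fun j => if h : 1 ≤ j ∧ j < φ then B j h.1 h.2 else fun _ => ∅, fun j h1 h2 => by
    simpa only [dif_pos (show 1 ≤ j ∧ j < φ from ⟨h1, h2⟩)] using hB j h1 h2⟩

end Size

end SetAuth

/-! ### Executions of a protocol, one flow at a time -/

namespace PMF

variable {α β : Type*}

theorem prob_map (p : PMF α) (f : α → β) (A : Set β) : (p.map f).prob A = p.prob (f ⁻¹' A) := by
  unfold prob
  rw [toOuterMeasure_map_apply]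

end PMF

namespace AuthProtocol

variable {𝒮 X Y Z : Type*} [Fintype Z]

/-- The part of a run against a type I attacker that follows an action `(x, u)` of Alice. -/
noncomputable def afterAlice (π : AuthProtocol 𝒮 X Z) (W₁ : Channel X Z)
    (A : (i : ℕ) → List (List X × ℕ × ℕ) → PMF (Option ((Fin (π.uses i) → X) × ℕ)))
    (O : TypeIAttacker X Z) (k : ℕ) (H : List (Exchange X Z)) (x : Fin (π.uses H.length) → X)
    (u : ℕ) : PMF (Option 𝒮) :=
  (W₁.transmit x).bind fun z =>
    (O.toBob H (List.ofFn x) (List.ofFn z) u).bind fun u' =>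
    if k = 0 then π.decide H.length (H.map fun e => (e.z, e.u', e.v)) z u'
    else
      (π.bob H.length (H.map fun e => (e.z, e.u', e.v)) z u').bind fun
        | none => PMF.pure none
        | some v =>
          (O.toAlice H (List.ofFn x) (List.ofFn z) u u' v).bind fun v' =>
          runI π W₁ A O k (H ++ [⟨List.ofFn x, List.ofFn z, u, u', v, v'⟩])

variable (π : AuthProtocol 𝒮 X Z) (W₁ : Channel X Z)
    (A : (i : ℕ) → List (List X × ℕ × ℕ) → PMF (Option ((Fin (π.uses i) → X) × ℕ)))
    (O : TypeIAttacker X Z) {S : Set (Option 𝒮)} {η δ : ℝ}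

theorem prob_runI_succ_le (hδ : 0 ≤ δ) (k : ℕ) (H : List (Exchange X Z))
    (bad : Set (Option ((Fin (π.uses H.length) → X) × ℕ)))
    (hbad : (A H.length (H.map fun e => (e.x, e.u, e.v'))).prob bad ≤ η)
    (hnone : none ∈ (A H.length (H.map fun e => (e.x, e.u, e.v'))).support → none ∉ S)
    (h : ∀ x u, some (x, u) ∈ (A H.length (H.map fun e => (e.x, e.u, e.v'))).support →
      some (x, u) ∉ bad → (π.afterAlice W₁ A O k H x u).prob S ≤ δ) :
    (π.runI W₁ A O (k + 1) H).prob S ≤ η + δ := by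
  rw [runI]
  refine PMF.prob_bind_le_add _ _ _ bad hδ hbad ?_
  rintro (_ | ⟨x, u⟩) hs hb
  · exact (PMF.prob_pure_of_notMem (hnone hs)).le.trans hδ
  · exact h x u hs hb

theorem prob_afterAlice_zero_le (hδ : 0 ≤ δ) (H : List (Exchange X Z))
    (x : Fin (π.uses H.length) → X) (u : ℕ) (bad : Set (Fin (π.uses H.length) → Z))
    (hbad : (W₁.transmit x).prob bad ≤ η)
    (h : ∀ z u', z ∉ bad →
      (π.decide H.length (H.map fun e => (e.z, e.u', e.v)) z u').prob S ≤ δ) :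
    (π.afterAlice W₁ A O 0 H x u).prob S ≤ η + δ := by
  rw [afterAlice]
  refine PMF.prob_bind_le_add _ _ _ bad hδ hbad fun z _ hz => ?_
  refine PMF.prob_bind_le _ _ _ hδ fun u' _ => ?_
  rw [if_pos rfl]
  exact h z u' hz

theorem prob_afterAlice_le (hη : 0 ≤ η) (hδ : 0 ≤ δ) {k : ℕ} (hk : k ≠ 0)
    (H : List (Exchange X Z)) (x : Fin (π.uses H.length) → X) (u : ℕ)
    (h : ∀ z, ∀ u' ∈ (O.toBob H (List.ofFn x) (List.ofFn z) u).support, ∃ bad : Set (Option ℕ),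
      (π.bob H.length (H.map fun e => (e.z, e.u', e.v)) z u').prob bad ≤ η ∧
      (none ∈ (π.bob H.length (H.map fun e => (e.z, e.u', e.v)) z u').support → none ∉ S) ∧
      ∀ v, some v ∈ (π.bob H.length (H.map fun e => (e.z, e.u', e.v)) z u').support →
        some v ∉ bad → ∀ v' ∈ (O.toAlice H (List.ofFn x) (List.ofFn z) u u' v).support,
        (π.runI W₁ A O k (H ++ [⟨List.ofFn x, List.ofFn z, u, u', v, v'⟩])).prob S ≤ δ) :
    (π.afterAlice W₁ A O k H x u).prob S ≤ η + δ := by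
  rw [afterAlice]
  refine PMF.prob_bind_le _ _ _ (add_nonneg hη hδ) fun z _ => ?_
  refine PMF.prob_bind_le _ _ _ (add_nonneg hη hδ) fun u' hu' => ?_
  rw [if_neg hk]
  obtain ⟨bad, h1, h2, h3⟩ := h z u' hu'
  refine PMF.prob_bind_le_add _ _ _ bad hδ h1 ?_
  rintro (_ | v) hs hb
  · exact (PMF.prob_pure_of_notMem (h2 hs)).le.trans hδ
  · exact PMF.prob_bind_le _ _ _ hδ (h3 v hs hb)

end AuthProtocol

namespace SetAuth

/-! ### The actions of the parties in the iterated set-system protocol -/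

section Pick

variable {v : ℕ → ℕ} {B : ℕ → ℕ → Finset ℕ} {l s' : ℕ}

theorem some_mem_support_pick {t : ℕ} (h : some t ∈ (pick v B l s').support) :
    t < v (l + 1) ∧ s' ∈ B l t := by
  unfold pick at h
  split_ifs at h with hne
  · rw [PMF.support_map] at h
    obtain ⟨t', ht', he⟩ := h
    rw [PMF.support_uniformOfFinset] at ht'
    cases Option.some_injective _ he
    simpa using ht'
  · rw [PMF.support_pure] at h
    exact absurd h (by simp)

theorem none_notMem_support_pick
    (hne : ((Finset.range (v (l + 1))).filter fun i => s' ∈ B l i).Nonempty) :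
    none ∉ (pick v B l s').support := by
  unfold pick
  rw [dif_pos hne, PMF.support_map]
  rintro ⟨t, -, ht⟩
  cases ht

/-- The block picked by the receiver of `s'` contains a given point `y` only with the probability
bounded by the ratio of the pair degree of `s'` and `y` to the degree of `s'`. -/
theorem prob_pick_le {y : ℕ} {ρ : ℝ} (hρ : 0 ≤ ρ)
    (h : (((Finset.range (v (l + 1))).filter fun i => y ∈ B l i ∧ s' ∈ B l i).card : ℝ) ≤
      ρ * ((Finset.range (v (l + 1))).filter fun i => s' ∈ B l i).card) :
    (pick v B l s').prob {o | ∃ t, o = some t ∧ y ∈ B l t} ≤ ρ := by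
  unfold pick
  split_ifs with hne
  · rw [PMF.prob_map]
    refine PMF.prob_uniformOfFinset_le _ hne _ _ (fun t ht hy => ?_) h
    obtain ⟨t', ht', hy⟩ := hy
    cases Option.some_injective _ ht'
    rw [Finset.mem_filter] at ht ⊢
    exact ⟨ht.1, hy, ht.2⟩
  · refine (PMF.prob_pure_of_notMem ?_).le.trans hρ
    rintro ⟨t, ht, -⟩
    cases ht

end Pick

variable {X Y Z : Type*} [Fintype Z]

open Classical in
/-- Bob's test of the first `k` output symbols: their type is close to the row of `a`. -/
def PassesTest (W₁ : Channel X Z) (a : X) (γ : ℝ) {k : ℕ} (z : Fin k → Z) : Prop :=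
  ∀ u, |empirical z u - W₁.toMatrix a u| ≤ γ / (2 * Fintype.card Z)

section Actions

variable (W₁ : Channel X Z) (a : X) (γ : ℝ) (k m : ℕ) {M : ℕ} (c : BlockCode X Z m M) (φ : ℕ)
    (v : ℕ → ℕ) (B : ℕ → ℕ → Finset ℕ)

theorem protocol_uses_eq {i : ℕ} (hi : 2 * i = φ) :
    (protocol W₁ a γ k m c φ v B).uses i = k + m := uses_eq hi

theorem alice_nil (s : Fin (v 1)) (i : ℕ) :
    (protocol W₁ a γ k m c φ v B).alice s i [] = PMF.pure (some (fun _ => a, (s : ℕ))) := rfl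

theorem alice_of_not_check (s : Fin (v 1)) {i : ℕ} {T : List (List X × ℕ × ℕ)} {x : List X}
    {prev s' : ℕ} (hT : T.getLast? = some (x, prev, s')) (h : ¬ Check v B (2 * i) prev s') :
    (protocol W₁ a γ k m c φ v B).alice s i T = PMF.pure none := by
  unfold protocol
  simp only [hT, if_neg h]

theorem alice_of_lt (s : Fin (v 1)) {i : ℕ} {T : List (List X × ℕ × ℕ)} {x : List X}
    {prev s' : ℕ} (hT : T.getLast? = some (x, prev, s')) (h : Check v B (2 * i) prev s')
    (hi : 2 * i ≠ φ) : (protocol W₁ a γ k m c φ v B).alice s i T =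
      (pick v B (2 * i) s').map (Option.map fun t => (fun _ => a, t)) := by
  unfold protocol
  simp only [hT, if_pos h, dif_neg hi]

/-- Alice's word in the last flow: the constant test word, then the codeword. -/
def lastWord (a : X) (k : ℕ) {m M : ℕ} (c : BlockCode X Z m M) {n : ℕ} (hn : n = k + m)
    (s' : Fin M) : Fin n → X :=
  fun j => Fin.append (fun _ : Fin k => a) (c.enc s') (Fin.cast hn j)

theorem alice_last (s : Fin (v 1)) {i : ℕ} {T : List (List X × ℕ × ℕ)} {x : List X}
    {prev s' : ℕ} (hT : T.getLast? = some (x, prev, s')) (h : Check v B (2 * i) prev s')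
    (hi : 2 * i = φ) (hs : s' < M) : (protocol W₁ a γ k m c φ v B).alice s i T =
      PMF.pure (some (lastWord a k c
        (protocol_uses_eq W₁ a γ k m c φ v B hi) ⟨s', hs⟩, 0)) := by
  unfold protocol
  simp only [hT, if_pos h, dif_pos hi, dif_pos hs]
  rfl

theorem alice_last_of_le (s : Fin (v 1)) {i : ℕ} {T : List (List X × ℕ × ℕ)} {x : List X}
    {prev s' : ℕ} (hT : T.getLast? = some (x, prev, s')) (h : Check v B (2 * i) prev s')
    (hi : 2 * i = φ) (hs : ¬ s' < M) :
    (protocol W₁ a γ k m c φ v B).alice s i T = PMF.pure none := by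
  unfold protocol
  simp only [hT, if_pos h, dif_pos hi, dif_neg hs]

open Classical in
theorem bob_eq (i : ℕ) (T : List (List Z × ℕ × ℕ))
    (z : Fin ((protocol W₁ a γ k m c φ v B).uses i) → Z) (s' : ℕ) :
    (protocol W₁ a γ k m c φ v B).bob i T z s' =
      if Check v B (2 * i + 1) ((T.getLast?.map fun e => e.2.2).getD 0) s' then
        pick v B (2 * i + 1) s' else PMF.pure none := rfl

open Classical in
theorem decide_eq {i : ℕ} {T : List (List Z × ℕ × ℕ)} {x₁ x₂ : List Z} {s₁ y₁ s₂ sφ : ℕ}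
    (h1 : T.head? = some (x₁, s₁, y₁)) (h2 : T.getLast? = some (x₂, s₂, sφ)) (hs : s₁ < v 1)
    (hi : 2 * i = φ)
    (z : Fin ((protocol W₁ a γ k m c φ v B).uses i) → Z) (u : ℕ) :
    (protocol W₁ a γ k m c φ v B).decide i T z u =
      if PassesTest W₁ a γ (fun j : Fin k => z (Fin.cast
          (protocol_uses_eq W₁ a γ k m c φ v B hi).symm (Fin.castAdd m j))) ∧
          (c.dec fun j => z (Fin.cast
            (protocol_uses_eq W₁ a γ k m c φ v B hi).symm (Fin.natAdd k j))).map Fin.val = some sφ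
      then PMF.pure (some ⟨s₁, hs⟩) else PMF.pure none := by
  unfold protocol
  simp only [h1, h2, dif_pos (show s₁ < v 1 ∧ 2 * i = φ from ⟨hs, hi⟩)]
  exact if_congr Iff.rfl rfl rfl

theorem decide_eq_none {i : ℕ} {T : List (List Z × ℕ × ℕ)} {x₁ : List Z} {s₁ y₁ : ℕ}
    (h1 : T.head? = some (x₁, s₁, y₁)) (hs : ¬ (s₁ < v 1 ∧ 2 * i = φ))

    (z : Fin ((protocol W₁ a γ k m c φ v B).uses i) → Z) (u : ℕ) :
    (protocol W₁ a γ k m c φ v B).decide i T z u = PMF.pure none := by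
  unfold protocol
  rcases h2 : T.getLast? with _ | ⟨x₂, s₂, sφ⟩
  · simp only [h1, h2]
  · simp only [h1, h2, dif_neg hs]

theorem decide_nil (i : ℕ)
    (z : Fin ((protocol W₁ a γ k m c φ v B).uses i) → Z) (u : ℕ) :
    (protocol W₁ a γ k m c φ v B).decide i [] z u = PMF.pure none := rfl

end Actions
end SetAuth

namespace SetAuth

variable {X Y Z : Type*} [Fintype Z]

theorem prob_transmit_lastWord (W : Channel X Z) (a : X) (k : ℕ) {m M n : ℕ}
    (c : BlockCode X Z m M) (hn : n = k + m) (s' : Fin M) (A : Set (Fin m → Z)) :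
    (W.transmit (lastWord a k c hn s')).prob
        {z | (fun j => z (Fin.cast hn.symm (Fin.natAdd k j))) ∈ A} =
      (W.transmit (c.enc s')).prob A := by
  subst hn
  refine (W.prob_transmit_natAdd _ A).trans ?_
  congr 2
  funext j
  simp [lastWord]

theorem prob_transmit_first (W : Channel X Z) (k : ℕ) {m n : ℕ} (hn : n = k + m) (y : Fin n → X)
    (A : Set (Fin k → Z)) :
    (W.transmit y).prob {z | (fun j => z (Fin.cast hn.symm (Fin.castAdd m j))) ∈ A} =
      (W.transmit fun j => y (Fin.cast hn.symm (Fin.castAdd m j))).prob A := by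
  subst hn
  exact W.prob_transmit_castAdd y A

variable (W₁ : Channel X Z) (a : X) (γ : ℝ) (k m : ℕ) {M : ℕ} (c : BlockCode X Z m M) (φ : ℕ)
    (v : ℕ → ℕ) (B : ℕ → ℕ → Finset ℕ)

/-- The protocol, with all its parameters. -/
local notation "⟪π⟫" => protocol W₁ a γ k m c φ v B

/-! ### Correctness -/

/-- In an honest run every message passes the check of its receiver, so that only the noisy
transmission in the last flow can fail. -/
theorem prob_correct_le (hφ : Even φ) (hφ0 : 0 < φ) (hM : v φ ≤ M)
    (hne : ∀ j, 1 ≤ j → j < φ → ∀ x < v j,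
      ((Finset.range (v (j + 1))).filter fun i => x ∈ B j i).Nonempty) {δ : ℝ}
    (hdec : ∀ s', c.errorProb W₁ s' ≤ δ)
    {η : ℝ} (htest : (W₁.transmit fun _ : Fin k => a).prob {z | ¬ PassesTest W₁ a γ z} ≤ η)
    (s : Fin (v 1)) (d : (i : ℕ) → List (List X × ℕ × ℕ) →
      Option ((Fin (⟪π⟫.uses i) → X) × ℕ))
    (hd : ⟪π⟫.IsAdmissible s d) :
    (⟪π⟫.runI W₁ (fun i T => PMF.pure (d i T))
      (TypeIAttacker.passive X Z) ⟪π⟫.turns []).prob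
      {o | o ≠ some s} ≤ η + δ := by
  classical
  set A : (i : ℕ) → List (List X × ℕ × ℕ) → PMF (Option ((Fin (⟪π⟫.uses i) → X) × ℕ)) :=
    fun i T => PMF.pure (d i T) with hA
  obtain ⟨t, ht⟩ := hφ
  have hη : 0 ≤ η := (PMF.prob_nonneg _ _).trans htest
  -- the honest exchange that starts with a message `u` of Alice
  have half : ∀ (k' : ℕ) (H : List (Exchange X Z)) (x : Fin (⟪π⟫.uses H.length) → X) (u : ℕ),
      H.length + (k' + 1) = t → u < v (2 * H.length + 1) → 0 ≤ δ →
      Check v B (2 * H.length + 1) ((H.getLast?.map fun e => e.v).getD 0) u →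
      (∀ (z : List Z) (w : ℕ), w < v (2 * H.length + 2) → u ∈ B (2 * H.length + 1) w →
        (⟪π⟫.runI W₁ A (TypeIAttacker.passive X Z) (k' + 1)
          (H ++ [⟨List.ofFn x, z, u, u, w, w⟩])).prob {o | o ≠ some s} ≤ η + δ) →
      (⟪π⟫.afterAlice W₁ A (TypeIAttacker.passive X Z) (k' + 1) H x u).prob {o | o ≠ some s}
        ≤ η + δ := by
    intro k' H x u hk hu hδ hcheck hrec
    rw [← zero_add (η + δ)]
    refine ⟪π⟫.prob_afterAlice_le W₁ A _ le_rfl (add_nonneg hη hδ) (Nat.succ_ne_zero k') H x u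
      fun z u' hu' => ⟨∅, ?_⟩
    obtain rfl : u' = u := by simpa [TypeIAttacker.passive] using hu'
    have hbob := bob_eq W₁ a γ k m c φ v B H.length (H.map fun e => (e.z, e.u', e.v)) z u'
    rw [List.getLast?_map, Option.map_map] at hbob
    rw [if_pos (by exact hcheck)] at hbob
    rw [hbob]
    have hne' := hne (2 * H.length + 1) (by omega) (by omega) u' hu
    refine ⟨(PMF.prob_eq_zero _ fun _ _ => id).le,
      fun h => absurd h (none_notMem_support_pick hne'), fun w hw _ v' hv' => ?_⟩
    obtain rfl : v' = w := by simpa [TypeIAttacker.passive] using hv'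
    obtain ⟨h1, h2⟩ := some_mem_support_pick hw
    exact hrec _ _ h1 h2
  have hlt : ∀ j, 1 ≤ j → j ≤ φ → 0 < v j := by
    intro j hj hjφ
    induction j, hj using Nat.le_induction with
    | base => exact s.pos
    | succ j hj ih =>
      obtain ⟨i, hi⟩ := hne j hj (by omega) 0 (ih (by omega))
      have := Finset.mem_range.1 (Finset.mem_filter.1 hi).1
      omega
  have hδ : 0 ≤ δ :=
    (PMF.prob_nonneg _ _).trans (hdec ⟨0, (hlt φ hφ0 le_rfl).trans_le hM⟩)
  have main : ∀ (k' : ℕ) (H : List (Exchange X Z)) (e₀ e : Exchange X Z), H.length + k' = t →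
      0 < H.length → H.head? = some e₀ → H.getLast? = some e → e₀.u' = s → e.v' = e.v →
      e.v < v (2 * H.length) → e.u ∈ B (2 * H.length - 1) e.v →
      (⟪π⟫.runI W₁ A (TypeIAttacker.passive X Z) (k' + 1) H).prob {o | o ≠ some s} ≤ η + δ := by
    intro k'
    induction k' with
    | zero =>
      intro H e₀ e hk hH hhead hlast hs hve hv hB
      have hT : (H.map fun e => (e.x, e.u, e.v')).getLast? = some (e.x, e.u, e.v) := by
        rw [List.getLast?_map, hlast, Option.map_some, hve]
      have hi : 2 * H.length = φ := by omega
      have huses := protocol_uses_eq W₁ a γ k m c φ v B hi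
      have hc : Check v B (2 * H.length) e.u e.v := ⟨hv, Or.inr hB⟩
      have hvM : e.v < M := by rw [hi] at hv; omega
      have hdm := hd H.length (H.map fun e => (e.x, e.u, e.v'))
      rw [alice_last W₁ a γ k m c φ v B s hT hc hi hvM, PMF.mem_support_pure_iff] at hdm
      rw [← zero_add (η + δ)]
      refine ⟪π⟫.prob_runI_succ_le W₁ A _ (add_nonneg hη hδ) 0 H ∅
        (PMF.prob_eq_zero _ fun _ _ => id).le ?_ ?_
      · intro h
        rw [PMF.mem_support_pure_iff, hdm] at h
        cases h
      · intro x u hxu _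
        rw [PMF.mem_support_pure_iff, hdm] at hxu
        obtain ⟨rfl, rfl⟩ := Prod.mk.inj (Option.some_injective _ hxu)
        rw [← add_zero (η + δ)]
        set bad₁ : Set (Fin (⟪π⟫.uses H.length) → Z) :=
          {z | (fun j => z (Fin.cast huses.symm (Fin.castAdd m j))) ∈
            {z : Fin k → Z | ¬ PassesTest W₁ a γ z}} with hbad₁
        set bad₂ : Set (Fin (⟪π⟫.uses H.length) → Z) :=
          {z | (fun j => z (Fin.cast huses.symm (Fin.natAdd k j))) ∈
            {z : Fin m → Z | c.dec z ≠ some ⟨e.v, hvM⟩}} with hbad₂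
        refine ⟪π⟫.prob_afterAlice_zero_le W₁ A _ le_rfl H _ 0 (bad₁ ∪ bad₂) ?_ fun z u' hz => ?_
        · refine (PMF.prob_union_le _ _ _).trans (add_le_add ?_ ?_)
          · refine (prob_transmit_first W₁ k huses _ _).le.trans (le_of_eq_of_le ?_ htest)
            congr 2
            funext j
            simp [lastWord]
          · exact (prob_transmit_lastWord W₁ a k c huses ⟨e.v, hvM⟩ _).le.trans (hdec _)
        · have hz1 : PassesTest W₁ a γ
              fun j : Fin k => z (Fin.cast huses.symm (Fin.castAdd m j)) := by
            by_contra h; exact hz (Or.inl h)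
          have hz2 : (c.dec fun j => z (Fin.cast huses.symm (Fin.natAdd k j))) =
              some ⟨e.v, hvM⟩ := by
            by_contra h; exact hz (Or.inr h)
          have h1 : (H.map fun e => (e.z, e.u', e.v)).head? = some (e₀.z, (s : ℕ), e₀.v) := by
            rw [List.head?_map, hhead, Option.map_some, hs]
          have h2 : (H.map fun e => (e.z, e.u', e.v)).getLast? = some (e.z, e.u', e.v) := by
            rw [List.getLast?_map, hlast, Option.map_some]
          rw [decide_eq W₁ a γ k m c φ v B h1 h2 s.2 hi, if_pos ⟨hz1, by rw [hz2]; rfl⟩]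
          exact (PMF.prob_pure_of_notMem (by simp)).le
    | succ k' ih =>
      intro H e₀ e hk hH hhead hlast hs hve hv hB
      have hT : (H.map fun e => (e.x, e.u, e.v')).getLast? = some (e.x, e.u, e.v) := by
        rw [List.getLast?_map, hlast, Option.map_some, hve]
      have hi : 2 * H.length ≠ φ := by omega
      have hc : Check v B (2 * H.length) e.u e.v := ⟨hv, Or.inr hB⟩
      have hdm := hd H.length (H.map fun e => (e.x, e.u, e.v'))
      rw [alice_of_lt W₁ a γ k m c φ v B s hT hc hi, PMF.support_map] at hdm
      obtain ⟨o, ho, hod⟩ := hdm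
      rcases o with _ | w
      · exact absurd ho (none_notMem_support_pick (hne _ (by omega) (by omega) _ hv))
      obtain ⟨hw1, hw2⟩ := some_mem_support_pick ho
      rw [← zero_add (η + δ)]
      refine ⟪π⟫.prob_runI_succ_le W₁ A _ (add_nonneg hη hδ) (k' + 1) H ∅
        (PMF.prob_eq_zero _ fun _ _ => id).le ?_ ?_
      · intro h
        rw [PMF.mem_support_pure_iff, ← hod] at h
        cases h
      · intro x u hxu _
        rw [PMF.mem_support_pure_iff, ← hod] at hxu
        obtain ⟨rfl, rfl⟩ := Prod.mk.inj (Option.some_injective _ hxu)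
        refine half k' H _ _ hk hw1 hδ ⟨hw1, Or.inr ?_⟩ fun z w' hw'1 hw'2 => ?_
        · rw [hlast]; exact hw2
        · have hlen : ∀ e' : Exchange X Z, (H ++ [e']).length = H.length + 1 := by simp
          refine ih _ e₀ _ (by rw [hlen]; omega) (by rw [hlen]; omega) ?_
            List.getLast?_concat hs rfl ?_ ?_
          · rw [List.head?_append, hhead]; rfl
          · rw [hlen]; exact hw'1
          · rw [hlen]; exact hw'2
  obtain ⟨k', rfl⟩ : ∃ k', t = k' + 1 := ⟨t - 1, by omega⟩
  have hturns : ⟪π⟫.turns = k' + 1 + 1 := by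
    change φ / 2 + 1 = _
    omega
  rw [hturns, ← zero_add (η + δ)]
  have hd0 := hd 0 []
  rw [alice_nil, PMF.mem_support_pure_iff] at hd0
  refine ⟪π⟫.prob_runI_succ_le W₁ A _ (add_nonneg hη hδ) (k' + 1) [] ∅
    (PMF.prob_eq_zero _ fun _ _ => id).le ?_ ?_
  · intro h
    rw [PMF.mem_support_pure_iff] at h
    exact absurd (h.trans hd0) (by simp)
  · intro x u hxu _
    rw [PMF.mem_support_pure_iff] at hxu
    obtain ⟨rfl, rfl⟩ := Prod.mk.inj (Option.some_injective _ (hxu.trans hd0))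
    refine half k' [] _ _ (by simp) s.2 hδ ⟨s.2, Or.inl rfl⟩ fun z w hw1 hw2 => ?_
    refine main k' _ _ _ ?_ ?_ rfl rfl rfl rfl ?_ ?_
    · simp only [List.nil_append, List.length_singleton]; omega
    · simp
    · exact hw1
    · exact hw2

/-! ### Type I attacks -/

/-- If the first message reaches Bob unchanged, he cannot accept another source state. -/
theorem prob_runI_eq_zero (O : TypeIAttacker X Z) (s : Fin (v 1))
    (A : (i : ℕ) → List (List X × ℕ × ℕ) →
      PMF (Option ((Fin (⟪π⟫.uses i) → X) × ℕ)))
    (k' : ℕ) (H : List (Exchange X Z)) (e₀ : Exchange X Z) (hhead : H.head? = some e₀)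
    (hs : e₀.u' = s) :
    (⟪π⟫.runI W₁ A O k' H).prob {o | o ≠ none ∧ o ≠ some s} ≤ 0 := by
  classical
  have hnone : (none : Option (Fin (v 1))) ∉ {o | o ≠ none ∧ o ≠ some s} := fun h => h.1 rfl
  induction k' generalizing H with
  | zero =>
    rw [AuthProtocol.runI]
    exact (PMF.prob_pure_of_notMem hnone).le
  | succ k' ih =>
    rw [← zero_add (0 : ℝ)]
    refine AuthProtocol.prob_runI_succ_le _ W₁ A O le_rfl k' H ∅
      (PMF.prob_eq_zero _ fun _ _ => id).le (fun _ => hnone) fun x u _ _ => ?_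
    rw [← zero_add (0 : ℝ)]
    rcases k'.eq_zero_or_pos with rfl | hk'
    · refine AuthProtocol.prob_afterAlice_zero_le _ W₁ A O le_rfl H x u ∅
        (PMF.prob_eq_zero _ fun _ _ => id).le fun z u' _ => ?_
      have h1 : (H.map fun e => (e.z, e.u', e.v)).head? = some (e₀.z, (s : ℕ), e₀.v) := by
        rw [List.head?_map, hhead, Option.map_some, hs]
      by_cases hi : 2 * H.length = φ
      · obtain ⟨e, he⟩ : ∃ e, (H.map fun e => (e.z, e.u', e.v)).getLast? = some e := by
          rcases hl : (H.map fun e => (e.z, e.u', e.v)).getLast? with _ | e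
          · exfalso
            rw [List.getLast?_eq_none_iff] at hl
            rw [hl] at h1
            cases h1
          · exact ⟨e, hl⟩
        rw [decide_eq W₁ a γ k m c φ v B h1 he s.2 hi]
        split_ifs
        · exact (PMF.prob_pure_of_notMem fun h => h.2 rfl).le
        · exact (PMF.prob_pure_of_notMem hnone).le
      · rw [decide_eq_none W₁ a γ k m c φ v B h1 fun h => hi h.2]
        exact (PMF.prob_pure_of_notMem hnone).le
    · refine AuthProtocol.prob_afterAlice_le _ W₁ A O le_rfl le_rfl hk'.ne' H x u
        fun z u' _ => ⟨∅, (PMF.prob_eq_zero _ fun _ _ => id).le, fun _ => hnone,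
          fun w _ _ v' _ => ih _ ?_⟩
      rw [List.head?_append, hhead]; rfl

/-- The views of the two parties, once different, stay different except with the probabilities
`ρ j` that the block picked by the receiver of message `j` contains the message that was sent; so
Alice finally sends the codeword of a message other than the one that Bob expects. -/
theorem prob_typeI_le (hφ : Even φ) (hφ0 : 0 < φ) {ρ : ℕ → ℝ} (hρ : ∀ j, 0 ≤ ρ j)
    (hpair : ∀ j, 1 ≤ j → j < φ → ∀ x < v j, ∀ y < v j, x ≠ y →
      (((Finset.range (v (j + 1))).filter fun i => x ∈ B j i ∧ y ∈ B j i).card : ℝ) ≤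
        ρ j * ((Finset.range (v (j + 1))).filter fun i => y ∈ B j i).card)
    {δ : ℝ} (hδ : 0 ≤ δ) (hdec : ∀ s', c.errorProb W₁ s' ≤ δ) (s : Fin (v 1))
    (O : TypeIAttacker X Z) :
    (⟪π⟫.runI W₁ (⟪π⟫.alice s) O
      ⟪π⟫.turns []).prob {o | o ≠ none ∧ o ≠ some s} ≤
      ∑ j ∈ Finset.Ico 1 φ, ρ j + δ := by
  classical
  obtain ⟨t, ht⟩ := hφ
  have hnone : (none : Option (Fin (v 1))) ∉ {o | o ≠ none ∧ o ≠ some s} := fun h => h.1 rfl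
  set U : ℕ → ℝ := fun j => ∑ i ∈ Finset.Ico j φ, ρ i + δ with hU
  have hU0 : ∀ j, 0 ≤ U j := fun j => add_nonneg (Finset.sum_nonneg fun i _ => hρ i) hδ
  have hUs : ∀ j < φ, U j = ρ j + U (j + 1) := fun j hj => by
    rw [hU]
    dsimp only
    rw [Finset.sum_eq_sum_Ico_succ_bot hj, add_assoc]
  -- The run after a message `u` of Alice. Bob receives `u` unchanged, where the rest of the run is
  -- harmless by the first hypothesis, or the views differ and he picks a block without `u` except
  -- with probability `ρ (2 i + 1)`.
  have half : ∀ (k' : ℕ) (H : List (Exchange X Z)) (x : Fin (⟪π⟫.uses H.length) → X) (u : ℕ),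
      H.length + (k' + 1) = t → u < v (2 * H.length + 1) →
      (∀ u', Check v B (2 * H.length + 1) ((H.getLast?.map fun e => e.v).getD 0) u' → u' = u →
        ∀ (z : List Z) (w v' : ℕ), (⟪π⟫.runI W₁ (⟪π⟫.alice s) O (k' + 1)
          (H ++ [⟨List.ofFn x, z, u, u', w, v'⟩])).prob {o | o ≠ none ∧ o ≠ some s} ≤ 0) →
      (∀ (z : List Z) (u' w v' : ℕ), w < v (2 * H.length + 2) → u ∉ B (2 * H.length + 1) w →
        (⟪π⟫.runI W₁ (⟪π⟫.alice s) O (k' + 1)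
          (H ++ [⟨List.ofFn x, z, u, u', w, v'⟩])).prob {o | o ≠ none ∧ o ≠ some s} ≤
          U (2 * H.length + 2)) →
      (⟪π⟫.afterAlice W₁ (⟪π⟫.alice s) O (k' + 1) H x u).prob {o | o ≠ none ∧ o ≠ some s}
        ≤ U (2 * H.length + 1) := by
    intro k' H x u hk hu heq hrec
    rw [hUs _ (by omega)]
    refine ⟪π⟫.prob_afterAlice_le W₁ _ O (hρ _) (hU0 _) (Nat.succ_ne_zero k') H x u
      fun z u' _ => ?_
    have hbob := bob_eq W₁ a γ k m c φ v B H.length (H.map fun e => (e.z, e.u', e.v)) z u'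
    rw [List.getLast?_map, Option.map_map] at hbob
    rw [hbob]
    by_cases hcheck : Check v B (2 * H.length + 1) ((H.getLast?.map fun e => e.v).getD 0) u'
    · rw [if_pos (by exact hcheck)]
      by_cases huu : u' = u
      · exact ⟨∅, (PMF.prob_eq_zero _ fun _ _ => id).le.trans (hρ _), fun _ => hnone,
          fun w _ _ v' _ => (heq u' hcheck huu _ w v').trans (hU0 _)⟩
      · refine ⟨{o | ∃ w, o = some w ∧ u ∈ B (2 * H.length + 1) w}, ?_, fun _ => hnone,
          fun w hw hb v' _ => ?_⟩
        · exact prob_pick_le (hρ _) (hpair _ (by omega) (by omega) u hu u' hcheck.1 (Ne.symm huu))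
        · exact hrec _ _ _ _ (some_mem_support_pick hw).1 fun h => hb ⟨w, rfl, h⟩
    · rw [if_neg (by exact hcheck)]
      refine ⟨∅, (PMF.prob_eq_zero _ fun _ _ => id).le.trans (hρ _), fun _ => hnone,
        fun w hw _ => ?_⟩
      rw [PMF.mem_support_pure_iff] at hw
      cases hw
  -- Invariant of an attack that is still under way: after the last exchange `e`, the attacker has
  -- either changed Bob's answer, or left it such that Alice rejects it.
  have main : ∀ (k' : ℕ) (H : List (Exchange X Z)) (e : Exchange X Z), H.length + k' = t →
      0 < H.length → H.getLast? = some e → e.v < v (2 * H.length) →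
      (e.v' = e.v → e.u ∉ B (2 * H.length - 1) e.v) →
      (⟪π⟫.runI W₁ (⟪π⟫.alice s) O (k' + 1) H).prob {o | o ≠ none ∧ o ≠ some s} ≤
        U (2 * H.length) := by
    intro k' H e hk hH hlast hv hne
    induction k' using Nat.strong_induction_on generalizing H e with | _ k' ih
    have hT : (H.map fun e => (e.x, e.u, e.v')).getLast? = some (e.x, e.u, e.v') := by
      rw [List.getLast?_map, hlast, Option.map_some]
    -- a rejection by Alice
    have hrej : ⟪π⟫.alice s H.length (H.map fun e => (e.x, e.u, e.v')) = PMF.pure none →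
        (⟪π⟫.runI W₁ (⟪π⟫.alice s) O (k' + 1) H).prob {o | o ≠ none ∧ o ≠ some s} ≤
          U (2 * H.length) := by
      intro hal
      rw [← zero_add (U _)]
      refine ⟪π⟫.prob_runI_succ_le W₁ _ O (hU0 _) k' H ∅ (PMF.prob_eq_zero _ fun _ _ => id).le
        (fun _ => hnone) fun x u hxu => ?_
      rw [hal, PMF.mem_support_pure_iff] at hxu
      cases hxu
    by_cases hc : Check v B (2 * H.length) e.u e.v'
    swap
    · exact hrej (alice_of_not_check W₁ a γ k m c φ v B s hT hc)
    have hmem : e.u ∈ B (2 * H.length - 1) e.v' := hc.2.resolve_left (by omega)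
    have hvne : e.v' ≠ e.v := fun h => hne h (h ▸ hmem)
    rcases k' with _ | k'
    · have hi : 2 * H.length = φ := by omega
      have huses := protocol_uses_eq W₁ a γ k m c φ v B hi
      by_cases hM : e.v' < M
      swap
      · exact hrej (alice_last_of_le W₁ a γ k m c φ v B s hT hc hi hM)
      have hal := alice_last W₁ a γ k m c φ v B s hT hc hi hM
      rw [← zero_add (U _)]
      refine ⟪π⟫.prob_runI_succ_le W₁ _ O (hU0 _) 0 H ∅ (PMF.prob_eq_zero _ fun _ _ => id).le
        (fun _ => hnone) fun x u hxu _ => ?_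
      rw [hal, PMF.mem_support_pure_iff] at hxu
      obtain ⟨rfl, rfl⟩ := Prod.mk.inj (Option.some_injective _ hxu)
      have hUφ : U (2 * H.length) = δ + 0 := by
        rw [hU, hi]; simp
      rw [hUφ]
      refine ⟪π⟫.prob_afterAlice_zero_le W₁ _ O le_rfl H _ 0
        {z | (fun j => z (Fin.cast huses.symm (Fin.natAdd k j))) ∈
            {z : Fin m → Z | c.dec z ≠ some ⟨e.v', hM⟩}} ?_ fun z u' hz => ?_
      · exact (prob_transmit_lastWord W₁ a k c huses ⟨e.v', hM⟩ _).le.trans (hdec _)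
      · have hz2 : (c.dec fun j => z (Fin.cast huses.symm (Fin.natAdd k j))) =
            some ⟨e.v', hM⟩ := by
          by_contra h; exact hz h
        have h2 : (H.map fun e => (e.z, e.u', e.v)).getLast? = some (e.z, e.u', e.v) := by
          rw [List.getLast?_map, hlast, Option.map_some]
        obtain ⟨e₀, h1⟩ : ∃ e₀, (H.map fun e => (e.z, e.u', e.v)).head? = some e₀ := by
          rcases H with _ | ⟨e₀, H⟩
          · cases hH
          · exact ⟨_, rfl⟩
        by_cases hs : e₀.2.1 < v 1
        · rw [decide_eq W₁ a γ k m c φ v B h1 h2 hs hi, if_neg]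
          · exact (PMF.prob_pure_of_notMem hnone).le
          · rintro ⟨-, h⟩
            rw [hz2] at h
            exact hvne (Option.some_injective _ h)
        · rw [decide_eq_none W₁ a γ k m c φ v B h1 fun h => hs h.1]
          exact (PMF.prob_pure_of_notMem hnone).le
    · have hi : 2 * H.length ≠ φ := by omega
      have hal := alice_of_lt W₁ a γ k m c φ v B s hT hc hi
      rw [hUs _ (by omega)]
      refine ⟪π⟫.prob_runI_succ_le W₁ _ O (hU0 _) (k' + 1) H
        {o | ∃ x w, o = some (x, w) ∧ e.v ∈ B (2 * H.length) w} ?_ (fun _ => hnone)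
        fun x u hxu hb => ?_
      · rw [hal, PMF.prob_map]
        refine (PMF.prob_mono _ ?_).trans (prob_pick_le (hρ _)
          (hpair _ (by omega) (by omega) e.v hv e.v' hc.1 hvne.symm))
        rintro (_ | w) ⟨x, w', ho, hw⟩
        · cases ho
        · obtain ⟨-, rfl⟩ := Prod.mk.inj (Option.some_injective _ ho)
          exact ⟨w, rfl, hw⟩
      · have hb' : e.v ∉ B (2 * H.length) u := fun h => hb ⟨x, u, rfl, h⟩
        rw [hal, PMF.support_map] at hxu
        obtain ⟨o, ho, hox⟩ := hxu
        rcases o with _ | w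
        · cases hox
        obtain ⟨-, rfl⟩ := Prod.mk.inj (Option.some_injective _ hox)
        refine half k' H x w hk (some_mem_support_pick ho).1 ?_ ?_
        · rintro u' hcheck rfl
          rw [hlast] at hcheck
          exact absurd (hcheck.2.resolve_left (by omega)) hb'
        · intro z u' w' v' hw' hwB
          have hlen : ∀ e' : Exchange X Z, (H ++ [e']).length = H.length + 1 := by simp
          refine (ih k' k'.lt_succ_self _ _ (by rw [hlen]; omega) (by rw [hlen]; omega)
            List.getLast?_concat ?_ ?_).trans_eq ?_
          · rw [hlen]; exact hw'
          · rw [hlen]; exact fun _ => hwB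
          · rw [hlen]; rfl
  obtain ⟨k', rfl⟩ : ∃ k', t = k' + 1 := ⟨t - 1, by omega⟩
  have hturns : ⟪π⟫.turns = k' + 1 + 1 := by
    change φ / 2 + 1 = _
    omega
  rw [hturns, ← zero_add (_ + δ)]
  refine ⟪π⟫.prob_runI_succ_le W₁ _ O (hU0 1) (k' + 1) [] ∅
    (PMF.prob_eq_zero _ fun _ _ => id).le (fun _ => hnone) fun x u hxu _ => ?_
  rw [List.map_nil, alice_nil, PMF.mem_support_pure_iff] at hxu
  obtain ⟨rfl, rfl⟩ := Prod.mk.inj (Option.some_injective _ hxu)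
  refine half k' [] _ _ (by simp) s.2 ?_ ?_
  · rintro u' - rfl z w v'
    exact prob_runI_eq_zero W₁ a γ k m c φ v B O s _ _ _ _ rfl rfl
  · intro z u' w v' hw hwB
    refine main k' _ _ ?_ ?_ rfl hw fun _ => hwB
    · simp only [List.nil_append, List.length_singleton]; omega
    · simp

/-! ### Type II attacks -/

/-- Only the first `k` symbols of the last flow matter: whatever the attacker sends over his
channel, they have to pass Bob's test. -/
theorem prob_typeII_le (W₂ : Channel Y Z) (hφ : Even φ) {δ : ℝ} (hδ : 0 ≤ δ)
    (htest : ∀ y : Fin k → Y, (W₂.transmit y).prob {z | PassesTest W₁ a γ z} ≤ δ)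
    (O : TypeIIAttacker ⟪π⟫.uses Y Z) :
    (⟪π⟫.runII W₂ O ⟪π⟫.turns []).prob {o | o ≠ none} ≤ δ := by
  classical
  have hnone : (none : Option (Fin (v 1))) ∉ {o | o ≠ none} := fun h => h rfl
  have main : ∀ (k' : ℕ) (H : List (List Y × List Z × ℕ × ℕ)), 2 * (H.length + k') = φ →
      (⟪π⟫.runII W₂ O (k' + 1) H).prob {o | o ≠ none} ≤ δ := by
    intro k'
    induction k' with
    | zero =>
      intro H hi
      rw [Nat.add_zero] at hi
      have huses := protocol_uses_eq W₁ a γ k m c φ v B hi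
      rw [AuthProtocol.runII]
      refine PMF.prob_bind_le _ _ _ hδ fun y _ => ?_
      rw [← add_zero δ]
      refine PMF.prob_bind_le_add _ _ _
        {z | (fun j => z (Fin.cast huses.symm
          (Fin.castAdd m j))) ∈ {z : Fin k → Z | PassesTest W₁ a γ z}} le_rfl ?_ fun z _ hz => ?_
      · exact (prob_transmit_first W₂ k huses y.1 _).le.trans
          (htest _)
      · rw [if_pos rfl]
        rcases hl : (H.map fun e => e.2).getLast? with _ | ⟨x₂, s₂, sφ⟩
        · rw [List.getLast?_eq_none_iff] at hl
          rw [hl, decide_nil]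
          exact (PMF.prob_pure_of_notMem hnone).le
        obtain ⟨⟨x₁, s₁, y₁⟩, h1⟩ : ∃ e₀, (H.map fun e => e.2).head? = some e₀ := by
          rcases H with _ | ⟨e₀, H⟩
          · cases hl
          · exact ⟨_, rfl⟩
        by_cases hs : s₁ < v 1
        · rw [decide_eq W₁ a γ k m c φ v B h1 hl hs hi, if_neg]
          · exact (PMF.prob_pure_of_notMem hnone).le
          · exact fun h => hz h.1
        · rw [decide_eq_none W₁ a γ k m c φ v B h1 fun h => hs h.1]
          exact (PMF.prob_pure_of_notMem hnone).le
    | succ k' ih =>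
      intro H hi
      rw [AuthProtocol.runII]
      refine PMF.prob_bind_le _ _ _ hδ fun y _ => PMF.prob_bind_le _ _ _ hδ fun z _ => ?_
      rw [if_neg (Nat.succ_ne_zero k')]
      refine PMF.prob_bind_le _ _ _ hδ ?_
      rintro (_ | w) _
      · exact (PMF.prob_pure_of_notMem hnone).le.trans hδ
      · refine ih _ ?_
        rw [List.length_append, List.length_singleton]
        omega
  obtain ⟨t, ht⟩ := hφ
  have hturns : ⟪π⟫.turns = t + 1 := by
    change φ / 2 + 1 = _
    omega
  rw [hturns]
  exact main t [] (by simp; omega)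

end SetAuth

/-! ### The test of Bob -/

section Distance

variable {Z : Type*} [Fintype Z]

theorem statDist_nonneg (P Q : Z → ℝ) : 0 ≤ statDist P Q :=
  Finset.sum_nonneg fun _ _ => abs_nonneg _

theorem statDistTo_le {P Q : Z → ℝ} {S : Set (Z → ℝ)} (hQ : Q ∈ S) :
    statDistTo P S ≤ statDist P Q :=
  csInf_le ⟨0, by rintro _ ⟨Q, -, rfl⟩; exact statDist_nonneg P Q⟩ ⟨Q, hQ, rfl⟩

theorem statDistTo_pos {P : Z → ℝ} {S : Set (Z → ℝ)} (hS : IsCompact S) (hne : S.Nonempty)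
    (hP : P ∉ S) : 0 < statDistTo P S := by
  obtain ⟨Q, hQ, h⟩ := hS.exists_sInf_image_eq hne (f := statDist P)
    (by unfold statDist; fun_prop)
  rw [statDistTo, h]
  refine (statDist_nonneg P Q).lt_of_ne fun h0 => hP ?_
  have : P = Q := funext fun z => by
    have := (Finset.sum_eq_zero_iff_of_nonneg fun z _ => abs_nonneg (P z - Q z)).1 h0.symm z
      (Finset.mem_univ z)
    exact sub_eq_zero.1 (abs_eq_zero.1 this)
  rwa [this]

end Distance

namespace Channel

variable {X Y Z : Type*}

theorem row_mem_hull (W : Channel Y Z) (y : Y) : W.toMatrix y ∈ W.hull :=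
  subset_convexHull ℝ _ ⟨y, rfl⟩

theorem mean_row_mem_hull (W : Channel Y Z) {k : ℕ} (hk : 0 < k) (y : Fin k → Y) :
    (fun u => (∑ j, W.toMatrix (y j) u) / k) ∈ W.hull := by
  have hk' : (0 : ℝ) < k := by exact_mod_cast hk
  have h := (convex_convexHull ℝ (Set.range fun x => W.toMatrix x)).sum_mem
    (t := Finset.univ) (w := fun _ : Fin k => (1 : ℝ) / k) (z := fun j => W.toMatrix (y j))
    (fun _ _ => by positivity) (by simp [hk'.ne']) fun j _ => W.row_mem_hull (y j)
  have hfun : (fun u => (∑ j, W.toMatrix (y j) u) / k) =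
      ∑ j, ((1 : ℝ) / k) • W.toMatrix (y j) := by
    funext u
    rw [Finset.sum_apply, Finset.sum_div]
    exact Finset.sum_congr rfl fun j _ => by simp [div_eq_inv_mul]
  rw [hfun]
  exact h

theorem isCompact_hull [Finite Y] (W : Channel Y Z) : IsCompact W.hull :=
  (Set.finite_range _).isCompact_convexHull ℝ

variable [Fintype Z]

/-- The distance between two distributions is at most `2`. -/
theorem statDistTo_hull_le_two [Nonempty Y] (W₁ : Channel X Z) (W₂ : Channel Y Z) (a : X) :
    statDistTo (W₁.toMatrix a) W₂.hull ≤ 2 := by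
  obtain ⟨y⟩ := ‹Nonempty Y›
  refine (statDistTo_le (W₂.row_mem_hull y)).trans ?_
  calc statDist (W₁.toMatrix a) (W₂.toMatrix y)
      ≤ ∑ z, (W₁.toMatrix a z + W₂.toMatrix y z) := Finset.sum_le_sum fun z _ => by
        rw [abs_le]
        constructor <;> linarith [W₁.toMatrix_nonneg a z, W₂.toMatrix_nonneg y z]
    _ = 2 := by rw [Finset.sum_add_distrib, W₁.sum_toMatrix, W₂.sum_toMatrix]; norm_num

/-- Concentration of the number of occurrences of `u` in the output; `σ = 1` is the upper tail and
`σ = -1` the lower one. -/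
theorem prob_count_deviation_le [DecidableEq Z] (W : Channel Y Z) {k : ℕ} (y : Fin k → Y) (u : Z)
    {t σ : ℝ} (ht : 0 < t) (ht2 : t ≤ 2) (hσ : |σ| = 1) :
    (W.transmit y).prob {z | t * k ≤ σ * (((Finset.univ.filter fun j => z j = u).card : ℝ) -
      ∑ j, W.toMatrix (y j) u)} ≤ Real.exp (-(t ^ 2 / 4 * k)) := by
  classical
  rw [W.prob_transmit]
  have hσ2 : σ ^ 2 = 1 := by rw [← sq_abs, hσ, one_pow]
  refine (sum_indicator_count_le (fun j => W.toMatrix (y j)) (fun j => W.toMatrix_nonneg _)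
    (fun j => W.sum_toMatrix _) (fun _ => {u}) (fun j => W.toMatrix (y j) u)
    (fun j => ?_) (s := σ * (t / 2)) ?_ (t / 2 * (t * k)) _ fun z hz => ?_).trans ?_
  · rw [Finset.sum_eq_single u]
    · rw [Set.indicator_of_mem (Set.mem_singleton u)]
    · exact fun z _ hz => Set.indicator_of_notMem (by simpa using hz) _
    · exact fun h => absurd (Finset.mem_univ u) h
  · rw [abs_mul, hσ, abs_of_pos (by positivity)]; linarith
  · have hz' : t * k ≤ σ * (((Finset.univ.filter fun j => z j = u).card : ℝ) -
      ∑ j, W.toMatrix (y j) u) := hz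
    have := mul_le_mul_of_nonneg_left hz' (show 0 ≤ t / 2 by positivity)
    simp only [Set.mem_singleton_iff]
    linarith
  · rw [Real.exp_le_exp, mul_pow, hσ2, one_mul]
    have : ∑ j, W.toMatrix (y j) u ≤ k := by
      calc ∑ j, W.toMatrix (y j) u ≤ ∑ _j : Fin k, (1 : ℝ) := Finset.sum_le_sum fun j _ => by
            rw [← W.sum_toMatrix (y j)]
            exact Finset.single_le_sum (fun z _ => W.toMatrix_nonneg _ z) (Finset.mem_univ u)
        _ = k := by simp
    have := mul_le_mul_of_nonneg_left this (show 0 ≤ (t / 2) ^ 2 by positivity)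
    linarith

end Channel

namespace SetAuth

variable {X Y Z : Type*} [Fintype Z]

/-- The honest test word fails Bob's test with exponentially small probability. -/
theorem prob_not_passesTest_le (W₁ : Channel X Z) (a : X) {γ t : ℝ}
    (ht : t = γ / (2 * Fintype.card Z)) (ht0 : 0 < t) (ht2 : t ≤ 2) {k : ℕ} (hk : 0 < k) :
    (W₁.transmit fun _ : Fin k => a).prob {z | ¬ PassesTest W₁ a γ z} ≤
      2 * Fintype.card Z * Real.exp (-(t ^ 2 / 4 * k)) := by
  classical
  have hk' : (0 : ℝ) < k := by exact_mod_cast hk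
  set E : ℝ → Z → Set (Fin k → Z) := fun σ u => {z | t * k ≤ σ *
    (((Finset.univ.filter fun j => z j = u).card : ℝ) - ∑ _j : Fin k, W₁.toMatrix a u)} with hE
  have hsub : {z : Fin k → Z | ¬ PassesTest W₁ a γ z} ⊆ ⋃ u, (E 1 u ∪ E (-1) u) := by
    intro z hz
    have hz' : ¬ PassesTest W₁ a γ z := hz
    rw [PassesTest, ← ht] at hz'
    push Not at hz'
    obtain ⟨u, hu⟩ := hz'
    refine Set.mem_iUnion.2 ⟨u, ?_⟩
    have hemp : empirical z u * k = ((Finset.univ.filter fun j => z j = u).card : ℝ) := by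
      rw [empirical, div_mul_cancel₀ _ hk'.ne']
    have hsum : ∑ _j : Fin k, W₁.toMatrix a u = W₁.toMatrix a u * k := by
      simp [mul_comm]
    rcases lt_abs.1 hu with h | h
    · left
      change t * k ≤ 1 * (_ - _)
      rw [← hemp, hsum, one_mul, ← sub_mul]
      exact mul_le_mul_of_nonneg_right h.le hk'.le
    · right
      change t * k ≤ -1 * (_ - _)
      rw [← hemp, hsum, ← sub_mul, ← mul_assoc, neg_one_mul]
      exact mul_le_mul_of_nonneg_right h.le hk'.le
  refine (PMF.prob_mono _ hsub).trans ((PMF.prob_iUnion_le _ _).trans ?_)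
  calc ∑ u, (W₁.transmit fun _ : Fin k => a).prob (E 1 u ∪ E (-1) u)
      ≤ ∑ _u : Z, (Real.exp (-(t ^ 2 / 4 * k)) + Real.exp (-(t ^ 2 / 4 * k))) :=
        Finset.sum_le_sum fun u _ => (PMF.prob_union_le _ _ _).trans
          (add_le_add (W₁.prob_count_deviation_le _ u ht0 ht2 (by simp))
            (W₁.prob_count_deviation_le _ u ht0 ht2 (by simp)))
    _ = _ := by rw [Finset.sum_const, Finset.card_univ, nsmul_eq_mul]; ring

/-- A word sent over `W₂` passes Bob's test with exponentially small probability: the mean `Q` of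
its output laws lies in `Cov(W₂)`, hence differs from the row of `a` by at least `2 t` at some
symbol `u`, and the frequency of `u` concentrates at `Q u`. -/
theorem prob_passesTest_le (W₁ : Channel X Z) (W₂ : Channel Y Z) (a : X) {t : ℝ}
    (ht : t = statDistTo (W₁.toMatrix a) W₂.hull / (2 * Fintype.card Z)) (ht0 : 0 < t)
    (ht2 : t ≤ 2) {k : ℕ} (hk : 0 < k) (y : Fin k → Y) :
    (W₂.transmit y).prob {z | PassesTest W₁ a (statDistTo (W₁.toMatrix a) W₂.hull) z} ≤
      Real.exp (-(t ^ 2 / 4 * k)) := by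
  classical
  have hk' : (0 : ℝ) < k := by exact_mod_cast hk
  set Q : Z → ℝ := fun u => (∑ j, W₂.toMatrix (y j) u) / k with hQ
  obtain ⟨u, hu⟩ : ∃ u, 2 * t ≤ |W₁.toMatrix a u - Q u| := by
    by_contra! hcon
    have hZ : (Finset.univ : Finset Z).Nonempty := by
      rw [Finset.univ_nonempty_iff]
      by_contra hempty
      rw [not_nonempty_iff] at hempty
      rw [Fintype.card_eq_zero, Nat.cast_zero, mul_zero, div_zero] at ht
      exact ht0.ne' ht
    have h1 := statDistTo_le (P := W₁.toMatrix a) (W₂.mean_row_mem_hull hk y)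
    have h2 : statDist (W₁.toMatrix a) Q < ∑ _u : Z, 2 * t :=
      Finset.sum_lt_sum_of_nonempty hZ fun u _ => hcon u
    have hcard : (0 : ℝ) < Fintype.card Z := by exact_mod_cast Finset.card_pos.2 hZ
    rw [Finset.sum_const, Finset.card_univ, nsmul_eq_mul, ht] at h2
    have h3 : (Fintype.card Z : ℝ) * (2 * (statDistTo (W₁.toMatrix a) W₂.hull /
        (2 * Fintype.card Z))) = statDistTo (W₁.toMatrix a) W₂.hull := by
      field_simp
    rw [h3] at h2
    exact absurd h1 (not_le.2 h2)
  have hQu : Q u * k = ∑ j, W₂.toMatrix (y j) u := div_mul_cancel₀ _ hk'.ne'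
  have hemp : ∀ z : Fin k → Z, empirical z u * k =
      ((Finset.univ.filter fun j => z j = u).card : ℝ) := fun z => by
    rw [empirical, div_mul_cancel₀ _ hk'.ne']
  rcases le_abs.1 hu with h | h
  · refine (PMF.prob_mono _ fun z hz => ?_).trans
      (W₂.prob_count_deviation_le y u ht0 ht2 (σ := 1) (by simp))
    have hz' : PassesTest W₁ a (statDistTo (W₁.toMatrix a) W₂.hull) z := hz
    have hzu := hz' u
    rw [← ht] at hzu
    have h1 : empirical z u - W₁.toMatrix a u ≥ -t := by
      refine le_trans (neg_le_neg ?_) (neg_abs_le _)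
      convert hzu using 4
    change t * k ≤ 1 * (_ - _)
    rw [← hemp, ← hQu, one_mul, ← sub_mul]
    exact mul_le_mul_of_nonneg_right (by linarith) hk'.le
  · refine (PMF.prob_mono _ fun z hz => ?_).trans
      (W₂.prob_count_deviation_le y u ht0 ht2 (σ := -1) (by simp))
    have hz' : PassesTest W₁ a (statDistTo (W₁.toMatrix a) W₂.hull) z := hz
    have hzu := hz' u
    rw [← ht] at hzu
    have h1 : empirical z u - W₁.toMatrix a u ≤ t := by
      refine le_trans (le_abs_self _) ?_
      convert hzu using 4
    change t * k ≤ -1 * (_ - _)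
    rw [← hemp, ← hQu, ← sub_mul, ← mul_assoc, neg_one_mul]
    exact mul_le_mul_of_nonneg_right (by linarith) hk'.le

/-! ### Bounds for long blocks -/

theorem tendsto_sqrt_atTop : Filter.Tendsto Nat.sqrt Filter.atTop Filter.atTop :=
  Filter.tendsto_atTop_atTop.2 fun b => ⟨b * b, fun _ ha => Nat.le_sqrt.2 ha⟩

theorem sqrt_add_natSqrt_le (n : ℕ) : √((n + Nat.sqrt n : ℕ) : ℝ) ≤ Nat.sqrt n + 2 := by
  rw [Real.sqrt_le_left (by positivity)]
  have h := Nat.sqrt_le_add n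
  have : n + Nat.sqrt n ≤ (Nat.sqrt n + 2) ^ 2 := by nlinarith
  exact_mod_cast this

theorem eventually_exp_sqrt_le {κ C : ℝ} (hκ : 0 < κ) (hC : 0 < C) :
    ∀ᶠ n : ℕ in Filter.atTop, C * Real.exp (-(κ * Nat.sqrt n)) ≤
      (2 : ℝ) ^ (-(κ / 2 * √((n + Nat.sqrt n : ℕ) : ℝ))) := by
  filter_upwards [(tendsto_natCast_atTop_atTop.comp tendsto_sqrt_atTop).eventually_ge_atTop
    (2 * (Real.log C + κ) / κ)] with n hn
  rw [Function.comp_apply, div_le_iff₀ hκ] at hn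
  have h1 := sqrt_add_natSqrt_le n
  have h0 : 0 ≤ √((n + Nat.sqrt n : ℕ) : ℝ) := Real.sqrt_nonneg _
  rw [← Real.exp_log hC, ← Real.exp_add, Real.rpow_def_of_pos two_pos, Real.exp_le_exp]
  have h2 : Real.log 2 * √((n + Nat.sqrt n : ℕ) : ℝ) ≤ Nat.sqrt n + 2 := by
    refine le_trans ?_ h1
    exact mul_le_of_le_one_left h0 (by linarith [Real.log_two_lt_d9])
  have h3 := mul_le_mul_of_nonneg_left h2 (show 0 ≤ κ / 2 by positivity)
  linarith

theorem eventually_rpow_le_exp_sqrt {κ β : ℝ} (hβ : 0 < β) :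
    ∀ᶠ n : ℕ in Filter.atTop, (2 : ℝ) ^ (-(β * n)) ≤ Real.exp (-(κ * Nat.sqrt n)) := by
  have hl := Real.log_pos one_lt_two
  filter_upwards [(tendsto_natCast_atTop_atTop.comp tendsto_sqrt_atTop).eventually_ge_atTop
    (κ / (Real.log 2 * β))] with n hn
  rw [Function.comp_apply, div_le_iff₀ (by positivity)] at hn
  rw [Real.rpow_def_of_pos two_pos, Real.exp_le_exp]
  have h1 : (Nat.sqrt n : ℝ) * Nat.sqrt n ≤ n := by exact_mod_cast Nat.sqrt_le n
  have h2 := mul_le_mul_of_nonneg_left hn (Nat.cast_nonneg (α := ℝ) (Nat.sqrt n))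
  have h3 := mul_le_mul_of_nonneg_left h1 (show 0 ≤ Real.log 2 * β by positivity)
  linarith

theorem eventually_two_le_threshold {β₂ : ℝ} (hβ₂ : 0 < β₂) :
    ∀ᶠ n : ℕ in Filter.atTop, 2 ≤ threshold β₂ n := by
  filter_upwards [tendsto_natCast_atTop_atTop.eventually_ge_atTop (2 / β₂)] with n hn
  rw [div_le_iff₀ hβ₂] at hn
  rw [threshold]
  linarith [Real.sqrt_nonneg (n : ℝ)]

theorem eventually_le_two_rpow_threshold {β₂ : ℝ} (hβ₂ : 0 < β₂) :
    ∀ᶠ n : ℕ in Filter.atTop, ((n + Nat.sqrt n : ℕ) : ℝ) ≤ (2 : ℝ) ^ threshold β₂ n := by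
  filter_upwards [tendsto_sqrt_atTop.eventually_ge_atTop 8] with n hn
  have key : ∀ k ≥ 8, 2 * (k + 1) ^ 2 ≤ 2 ^ k := by
    intro k hk
    induction k, hk using Nat.le_induction with
    | base => norm_num
    | succ k hk ih =>
      have := pow_succ 2 k
      nlinarith
  have h1 : n + Nat.sqrt n ≤ 2 ^ Nat.sqrt n := by
    refine le_trans ?_ (key _ hn)
    have h := Nat.sqrt_le_add n
    nlinarith
  calc ((n + Nat.sqrt n : ℕ) : ℝ) ≤ (2 : ℝ) ^ Nat.sqrt n := by exact_mod_cast h1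
    _ = (2 : ℝ) ^ (Nat.sqrt n : ℝ) := (Real.rpow_natCast 2 _).symm
    _ ≤ _ := Real.rpow_le_rpow_of_exponent_le one_le_two (by
      rw [threshold]
      have := Real.nat_sqrt_le_real_sqrt (a := n)
      have : 0 ≤ β₂ * n := by positivity
      linarith)

/-- The messages of flow `φ` can be encoded, because `4 β₁ + β₂ < R`. -/
theorem eventually_size_bound_le {R β₁ β₂ : ℝ} (hβ₂ : 0 < β₂)
    (hR : β₂ < R - 4 * β₁) : ∀ᶠ n : ℕ in Filter.atTop,
      (2 : ℝ) ^ (9 + 4 * β₁ * n) * (2 ^ threshold β₂ n + 2 * (10 + 4 * β₁ * n)) ≤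
        (2 : ℝ) ^ (n * R) := by
  set ζ := R - 4 * β₁ - β₂ with hζ
  have hζ0 : 0 < ζ := by linarith
  have hev := fun x : ℝ => tendsto_natCast_atTop_atTop (R := ℝ).eventually_ge_atTop x
  filter_upwards [hev 1, hev (2 / β₂), hev (4 * (20 + 8 * β₁) / β₂ ^ 2), hev (4 / ζ ^ 2),
    hev (20 / ζ)] with n h1 h2 h3 h4 h5
  have hn0 : (0 : ℝ) ≤ n := by linarith
  rw [div_le_iff₀ hβ₂] at h2
  rw [div_le_iff₀ (by positivity)] at h3 h4
  rw [div_le_iff₀ hζ0] at h5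
  -- the linear term is dominated by `2 ^ (β₂ n)`
  have hlin : 2 * (10 + 4 * β₁ * n) ≤ (2 : ℝ) ^ threshold β₂ n := by
    have hb := one_add_mul_self_le_rpow_one_add (s := 1) (p := β₂ * n / 2) (by norm_num)
      (by linarith)
    rw [mul_one, one_add_one_eq_two] at hb
    have hsq : (2 : ℝ) ^ (β₂ * n) = (2 : ℝ) ^ (β₂ * n / 2) * (2 : ℝ) ^ (β₂ * n / 2) := by
      rw [← Real.rpow_add two_pos, add_halves]
    have hb0 : 0 ≤ β₂ * n / 2 := by positivity
    have hmul := mul_le_mul hb hb (by linarith) (by positivity)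
    have h3' := mul_le_mul_of_nonneg_left h3 hn0
    have hβ1n : 20 ≤ 20 * (n : ℝ) := by linarith
    calc 2 * (10 + 4 * β₁ * n) ≤ (2 : ℝ) ^ (β₂ * n) := by rw [hsq]; nlinarith
      _ ≤ _ := Real.rpow_le_rpow_of_exponent_le one_le_two (by
        rw [threshold]; linarith [Real.sqrt_nonneg (n : ℝ)])
  have hsqrt : √(n : ℝ) ≤ ζ / 2 * n := by
    rw [Real.sqrt_le_left (by positivity)]
    have := mul_le_mul_of_nonneg_left h4 hn0
    nlinarith
  calc (2 : ℝ) ^ (9 + 4 * β₁ * n) * (2 ^ threshold β₂ n + 2 * (10 + 4 * β₁ * n))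
      ≤ (2 : ℝ) ^ (9 + 4 * β₁ * n) * (2 * 2 ^ threshold β₂ n) :=
        mul_le_mul_of_nonneg_left (by linarith) (by positivity)
    _ = (2 : ℝ) ^ (9 + 4 * β₁ * n + (1 + threshold β₂ n)) := by
        rw [Real.rpow_add two_pos (9 + _), Real.rpow_add two_pos 1, Real.rpow_one]
    _ ≤ _ := Real.rpow_le_rpow_of_exponent_le one_le_two (by
        rw [threshold]
        have : ζ * n = n * R - 4 * β₁ * n - β₂ * n := by rw [hζ]; ring
        linarith)

/-- Geometric series with ratio `2 ^ (-1/4) ≤ 7/8`. -/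
theorem sum_rpow_le_seven (φ : ℕ) :
    ∑ j ∈ Finset.Ico 1 φ, (2 : ℝ) ^ (-(1 / 4) * ((φ : ℝ) - j)) ≤ 7 := by
  have hx : (2 : ℝ) ^ (-(1 / 4) : ℝ) ≤ 7 / 8 := by
    refine le_of_pow_le_pow_left₀ (n := 4) (by norm_num) (by norm_num) ?_
    rw [← Real.rpow_natCast, ← Real.rpow_mul two_pos.le]
    norm_num
  induction φ with
  | zero => simp
  | succ φ ih =>
    rcases φ.eq_zero_or_pos with rfl | hφ
    · simp
    · have hstep : ∑ j ∈ Finset.Ico 1 (φ + 1), (2 : ℝ) ^ (-(1 / 4) * (((φ + 1 : ℕ) : ℝ) - j)) =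
          (2 : ℝ) ^ (-(1 / 4) : ℝ) *
            (∑ j ∈ Finset.Ico 1 φ, (2 : ℝ) ^ (-(1 / 4) * ((φ : ℝ) - j)) + 1) := by
        rw [Finset.sum_Ico_succ_top hφ, mul_add, Finset.mul_sum, mul_one]
        congr 1
        · refine Finset.sum_congr rfl fun j _ => ?_
          rw [← Real.rpow_add two_pos]
          congr 1; push_cast; ring
        · congr 1; push_cast; ring
      rw [hstep]
      calc _ ≤ 7 / 8 * ((7 : ℝ) + 1) := mul_le_mul hx (by linarith)
            (add_nonneg (Finset.sum_nonneg fun j _ => by positivity) zero_le_one) (by norm_num)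
        _ = 7 := by norm_num

end SetAuth

namespace SetAuth

/-! ### Security of `SetAuth*` -/

/-- The degree bounds make every pick possible. -/
theorem AreSetSystems.nonempty {φ : ℕ} {ε : ℝ} {v : ℕ → ℕ} {B : ℕ → ℕ → Finset ℕ}
    (hB : AreSetSystems φ ε v B) (hε : 0 < ε) (hv : ∀ j, 1 ≤ j → j ≤ φ → 0 < v j) {j : ℕ}
    (hj : 1 ≤ j) (hjφ : j < φ) {x : ℕ} (hx : x < v j) :
    ((Finset.range (v (j + 1))).filter fun i => x ∈ B j i).Nonempty := by
  have h := (hB j hj hjφ).le_card x (Finset.mem_range.2 hx)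
  have hpos : (0 : ℝ) < v (j + 1) := by exact_mod_cast hv (j + 1) (by omega) hjφ
  rw [← Finset.card_pos]
  exact_mod_cast (show (0 : ℝ) < _ by positivity).trans_le h

/-- The ratio of the bounds on pair degrees and degrees. -/
theorem AreSetSystems.card_pair_le {φ : ℕ} {ε : ℝ} {v : ℕ → ℕ} {B : ℕ → ℕ → Finset ℕ}
    (hB : AreSetSystems φ ε v B) (hε : 0 < ε) {j : ℕ} (hj : 1 ≤ j) (hjφ : j < φ) {x y : ℕ}
    (hx : x < v j) (hy : y < v j) (hxy : x ≠ y) :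
    (((Finset.range (v (j + 1))).filter fun i => x ∈ B j i ∧ y ∈ B j i).card : ℝ) ≤
      ((2 : ℝ) ^ (-(1 / 4) * ((φ : ℝ) - j)) * ε) *
        ((Finset.range (v (j + 1))).filter fun i => y ∈ B j i).card := by
  have h := hB j hj hjφ
  refine (h.card_le x (Finset.mem_range.2 hx) y (Finset.mem_range.2 hy) hxy).trans ?_
  refine le_trans (le_of_eq ?_)
    (mul_le_mul_of_nonneg_left (h.le_card y (Finset.mem_range.2 hy)) (by positivity))
  have : (2 : ℝ) ^ (-(1 / 2) * ((φ : ℝ) - j) - 2) =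
      2 ^ (-(1 / 4) * ((φ : ℝ) - j)) * 2 ^ (-(1 / 4) * ((φ : ℝ) - j) - 2) := by
    rw [← Real.rpow_add two_pos]
    congr 1; ring
  rw [this]
  ring

variable {X Y Z : Type*} [Fintype Z]

theorem rounds_setAuth (W₁ : Channel X Z) (W₂ : Channel Y Z) (a : X) (β₁ β₂ : ℝ) (n' : ℕ) {M : ℕ}
    (c : BlockCode X Z n' M) (v₁ : ℕ) (B : ℕ → ℕ → Finset ℕ) (he : Even (phi β₂ n' v₁)) :
    (setAuth W₁ W₂ a β₁ β₂ n' c v₁ B).rounds = phi β₂ n' v₁ + 1 := by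
  obtain ⟨t, ht⟩ := he
  change 2 * (phi β₂ n' v₁ / 2 + 1) - 1 = _
  omega

theorem channelUses_setAuth (W₁ : Channel X Z) (W₂ : Channel Y Z) (a : X) (β₁ β₂ : ℝ) (n' : ℕ)
    {M : ℕ} (c : BlockCode X Z n' M) (v₁ : ℕ) (B : ℕ → ℕ → Finset ℕ)
    (he : Even (phi β₂ n' v₁)) :
    (setAuth W₁ W₂ a β₁ β₂ n' c v₁ B).channelUses = n' + Nat.sqrt n' := by
  obtain ⟨t, ht⟩ := he
  change ∑ i ∈ Finset.range (phi β₂ n' v₁ / 2 + 1), uses (phi β₂ n' v₁) (Nat.sqrt n') n' i = _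
  rw [Finset.sum_eq_single (phi β₂ n' v₁ / 2), uses_eq (by omega), add_comm]
  · intro i _ hi
    exact if_neg (by omega)
  · intro h
    exact absurd (Finset.mem_range.2 (Nat.lt_succ_self _)) h

/-- Security of the protocol from bounds on the parameters. Here `t` is the tolerance of Bob's test,
`κ` a lower bound for the exponent `t² / 4` of its error, and `e` a common bound for the error terms. -/
theorem isSecure_setAuth (W₁ : Channel X Z) (W₂ : Channel Y Z) (a : X) {β₁ β₂ : ℝ} {n' : ℕ} {M : ℕ}
    (c : BlockCode X Z n' M) {v₁ : ℕ} (hv : 2 ≤ v₁) {B : ℕ → ℕ → Finset ℕ}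
    (hB : Admits β₁ β₂ n' v₁ B) (hβ₁ : 0 < β₁) (hthr : 2 ≤ threshold β₂ n')
    (hM : ⌊(2 : ℝ) ^ (9 + 4 * β₁ * n') *
      (2 ^ threshold β₂ n' + 2 * (10 + 4 * β₁ * n'))⌋₊ ≤ M)
    (hn : 0 < n') {t κ e δ : ℝ}
    (ht : t = statDistTo (W₁.toMatrix a) W₂.hull / (2 * Fintype.card Z)) (ht0 : 0 < t)
    (ht2 : t ≤ 2) (hκ : κ ≤ t ^ 2 / 4) (he : e = Real.exp (-(κ * Nat.sqrt n')))
    (herr : ∀ i, c.errorProb W₁ i ≤ e) (hε : eps β₁ n' ≤ e)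
    (hδ : (2 * Fintype.card Z + 8) * e ≤ δ) :
    (setAuth W₁ W₂ a β₁ β₂ n' c v₁ B).IsSecure W₁ W₂ δ := by
  obtain ⟨hφ0, hφe, hφT⟩ := phi_spec hthr hv
  have hL := fun t (ht : t < phi β₂ n' v₁) => one_le_iterate_of_lt_phi hthr hv ht
  set φ := phi β₂ n' v₁ with hφ
  have hφ2 : 2 ≤ φ := by obtain ⟨r, hr⟩ := hφe; omega
  set ε := eps β₁ n' with hεdef
  have hε0 : 0 < ε := by rw [hεdef, eps]; positivity
  have hε4 : ε ^ 4 = (2 : ℝ) ^ (-(4 * β₁ * n')) := by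
    rw [hεdef, eps, ← Real.rpow_natCast, ← Real.rpow_mul two_pos.le]
    congr 1; push_cast; ring
  have hc0 : 0 ≤ 4 * β₁ * n' := by positivity
  have he0 : 0 < e := by rw [he]; exact Real.exp_pos _
  have hk : 0 < Nat.sqrt n' := Nat.sqrt_pos.2 hn
  have hexp : Real.exp (-(t ^ 2 / 4 * Nat.sqrt n')) ≤ e := by
    rw [he, Real.exp_le_exp]
    exact neg_le_neg (mul_le_mul_of_nonneg_right hκ (Nat.cast_nonneg _))
  have hsize : ∀ j, 1 ≤ j → j ≤ φ → 0 < size φ ε v₁ j := fun j hj hjφ =>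
    two_pos.trans_le (two_le_size hε4 hc0 hv hj hjφ)
  have hZ : (0 : ℝ) ≤ Fintype.card Z := Nat.cast_nonneg _
  have hB' : AreSetSystems φ ε (size φ ε v₁) B := hB
  refine ⟨fun s d hd => ?_, fun s O => ?_, fun O => ?_⟩
  · refine (prob_correct_le W₁ a _ _ n' c φ (size φ ε v₁) B hφe hφ0 ?_
      (fun j hj hjφ x hx => hB'.nonempty hε0 hsize hj hjφ hx) herr
      (prob_not_passesTest_le W₁ a ht ht0 ht2 hk) s d hd).trans ?_
    · exact (Nat.le_floor (size_phi_le hε4 hc0 hv hφ2 hL hφT)).trans hM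
    · have := mul_le_mul_of_nonneg_left hexp (show (0 : ℝ) ≤ 2 * Fintype.card Z by positivity)
      linarith
  · refine (prob_typeI_le W₁ a _ _ n' c φ (size φ ε v₁) B hφe hφ0
      (ρ := fun j => (2 : ℝ) ^ (-(1 / 4) * ((φ : ℝ) - j)) * ε) (fun j => by positivity)
      (fun j hj hjφ x hx y hy hxy => hB'.card_pair_le hε0 hj hjφ hx hy hxy) he0.le herr
      s O).trans ?_
    rw [← Finset.sum_mul]
    have := mul_le_mul_of_nonneg_right (sum_rpow_le_seven φ) hε0.le
    have : 0 ≤ 2 * (Fintype.card Z : ℝ) * e := by positivity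
    linarith
  · refine prob_typeII_le W₁ a _ _ n' c φ (size φ ε v₁) B W₂ hφe ?_ (fun y =>
      (prob_passesTest_le W₁ W₂ a ht ht0 ht2 hk y).trans (hexp.trans ?_)) O
    · exact (by positivity : 0 ≤ (2 * (Fintype.card Z : ℝ) + 8) * e).trans hδ
    · have : 0 ≤ 2 * (Fintype.card Z : ℝ) * e := by positivity
      linarith

end SetAuth

theorem mainTheorem1 {X Y Z : Type*} [Fintype X] [Fintype Y] [Nonempty Y] [Fintype Z]
    (W₁ : Channel X Z) (W₂ : Channel Y Z)
    (hcov : ¬ W₁.hull ⊆ W₂.hull) (hdim : 1 < W₁.toMatrix.rank) :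
    -- the ingredients of the construction exist
    (∃ a, W₁.toMatrix a ∉ W₂.hull) ∧
    0 < W₁.capacity ∧
    (∀ R : ℝ, 0 < R → R < W₁.capacity → ∃ c : CodeFamily X Z R, c.ExpReliable W₁) ∧
    -- the constant depends on the two channels only
    ∃ ξ : ℝ, 0 < ξ ∧
      ∀ a, W₁.toMatrix a ∉ W₂.hull →
      ∀ R β₁ β₂ : ℝ, R < W₁.capacity → 0 < β₁ → β₁ < R / 4 → 0 < β₂ → β₂ < R - 4 * β₁ →
      ∀ c : CodeFamily X Z R, c.ExpReliable W₁ →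
      -- how large the number of channel uses has to be does not depend on the source size
      ∃ N : ℕ, ∀ n' ≥ N, ∀ v₁ ≥ 2,
        (∃ B, SetAuth.Admits β₁ β₂ n' v₁ B) ∧
        ∀ B, SetAuth.Admits β₁ β₂ n' v₁ B →
          (setAuth W₁ W₂ a β₁ β₂ n' (c n') v₁ B).IsSecure W₁ W₂
            ((2 : ℝ) ^ (-(ξ * √((n' + Nat.sqrt n' : ℕ) : ℝ)))) ∧
          (setAuth W₁ W₂ a β₁ β₂ n' (c n') v₁ B).channelUses = n' + Nat.sqrt n' ∧
          (SetAuth.threshold β₂ n' < v₁ →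
            ((setAuth W₁ W₂ a β₁ β₂ n' (c n') v₁ B).rounds : ℤ) ≤
              (logStar v₁ : ℤ) - (logStar ((n' + Nat.sqrt n' : ℕ) : ℝ) : ℤ) + 4) ∧
          ((v₁ : ℝ) ≤ SetAuth.threshold β₂ n' →
            (setAuth W₁ W₂ a β₁ β₂ n' (c n') v₁ B).rounds = 3) := by
  have hex : ∃ a, W₁.toMatrix a ∉ W₂.hull := by
    by_contra! hcon
    exact hcov (convexHull_min (by rintro _ ⟨a, rfl⟩; exact hcon a) (convex_convexHull ℝ _))
  have hX : Nonempty X := hex.nonempty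
  obtain ⟨y₀⟩ := ‹Nonempty Y›
  have hZ : Nonempty Z := (W₂ y₀).support_nonempty.to_type
  have hcard : (1 : ℝ) ≤ Fintype.card Z := by exact_mod_cast Fintype.card_pos
  refine ⟨hex, W₁.capacity_pos hdim, fun R _ hR => W₁.exists_expReliable hR, ?_⟩
  set t : X → ℝ := fun a => statDistTo (W₁.toMatrix a) W₂.hull / (2 * Fintype.card Z) with ht
  have ht0 : ∀ a, W₁.toMatrix a ∉ W₂.hull → 0 < t a := fun a ha =>
    div_pos (statDistTo_pos W₂.isCompact_hull ⟨_, W₂.row_mem_hull y₀⟩ ha) (by positivity)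
  have ht2 : ∀ a, t a ≤ 2 := fun a => by
    rw [ht]
    dsimp only
    rw [div_le_iff₀ (by positivity)]
    have : Nonempty Y := ⟨y₀⟩
    linarith [Channel.statDistTo_hull_le_two W₁ W₂ a]
  -- one rate that serves all admissible inputs `a`
  obtain ⟨κ, hκ0, hκ⟩ : ∃ κ : ℝ, 0 < κ ∧ ∀ a, W₁.toMatrix a ∉ W₂.hull → κ ≤ t a ^ 2 / 4 := by
    have hev : ∀ᶠ κ : ℝ in nhdsWithin 0 (Set.Ioi 0),
        ∀ a, W₁.toMatrix a ∉ W₂.hull → κ ≤ t a ^ 2 / 4 := by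
      rw [Filter.eventually_all]
      intro a
      by_cases ha : W₁.toMatrix a ∈ W₂.hull
      · exact Filter.Eventually.of_forall fun κ h => absurd ha h
      · have := ht0 a ha
        exact ((eventually_le_nhds (show (0 : ℝ) < t a ^ 2 / 4 by positivity)).filter_mono
          nhdsWithin_le_nhds).mono fun κ h _ => h
    obtain ⟨κ, h1, h2⟩ := (hev.and self_mem_nhdsWithin).exists
    exact ⟨κ, h2, h1⟩
  refine ⟨κ / 2, by positivity, ?_⟩
  intro a ha R β₁ β₂ _ hβ₁ _ hβ₂ hR c hc
  obtain ⟨α, hα, herr⟩ := hc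
  have hall := (SetAuth.eventually_exp_sqrt_le hκ0
    (show (0 : ℝ) < 2 * Fintype.card Z + 8 by positivity)).and <|
    herr.and <| (SetAuth.eventually_rpow_le_exp_sqrt (κ := κ) hα).and <|
    (SetAuth.eventually_rpow_le_exp_sqrt (κ := κ) hβ₁).and <|
    (SetAuth.eventually_two_le_threshold hβ₂).and <|
    (SetAuth.eventually_le_two_rpow_threshold hβ₂).and <|
    (SetAuth.eventually_size_bound_le hβ₂ hR).and <|
    (tendsto_natCast_atTop_atTop.eventually_ge_atTop (2 / β₁)).and (Filter.eventually_gt_atTop 0)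
  obtain ⟨N, hN⟩ := Filter.eventually_atTop.1 hall
  refine ⟨N, fun n' hn' v₁ hv => ?_⟩
  obtain ⟨hδ, herr, hαn, hεn, hthr, hnthr, hsz, hβn, hn0⟩ := hN n' hn'
  have hε4 : SetAuth.eps β₁ n' ^ 4 = (2 : ℝ) ^ (-(4 * β₁ * n')) := by
    rw [SetAuth.eps, ← Real.rpow_natCast, ← Real.rpow_mul two_pos.le]
    congr 1; push_cast; ring
  have hε1 : SetAuth.eps β₁ n' ≤ 1 / 4 := by
    rw [div_le_iff₀ hβ₁] at hβn
    calc SetAuth.eps β₁ n' ≤ (2 : ℝ) ^ (-2 : ℝ) :=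
          Real.rpow_le_rpow_of_exponent_le one_le_two (by linarith)
      _ = 1 / 4 := by rw [Real.rpow_neg two_pos.le]; norm_num
  obtain ⟨-, hφe, -⟩ := SetAuth.phi_spec hthr hv
  refine ⟨SetAuth.exists_areSetSystems hε4 (by positivity)
    (by rw [SetAuth.eps]; positivity) hε1 hv, fun B hB => ⟨?_, ?_, fun h => ?_, fun h => ?_⟩⟩
  · exact SetAuth.isSecure_setAuth W₁ W₂ a (c n') hv hB hβ₁ hthr (Nat.floor_mono hsz) hn0
      (t := t a) rfl (ht0 a ha) (ht2 a) (hκ a ha) rfl (fun i => (herr i).trans hαn) hεn hδ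
  · exact SetAuth.channelUses_setAuth W₁ W₂ a β₁ β₂ n' (c n') v₁ B hφe
  · rw [SetAuth.rounds_setAuth W₁ W₂ a β₁ β₂ n' (c n') v₁ B hφe]
    exact SetAuth.phi_add_one_le hthr hv h hnthr
  · rw [SetAuth.rounds_setAuth W₁ W₂ a β₁ β₂ n' (c n') v₁ B hφe, SetAuth.phi_eq_two hthr hv h]
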